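/- **Theorem 4.1 (Convergence on periodic noise models).** *Setting.* For $M\ge 2$ let $v_1,\dots,v_M$ be the roots of the $M$-th (physicists') Hermite polynomial $H_M$ and let $w_m=\int_{\mathbb R}\prod_{k\ne m}\frac{v-v_k}{v_m-v_k}\,e^{-v^2}\,dv$ be the corresponding Gauss–Hermite quadrature weights. Let $\xi_1,\dots,\xi_d$ be orthonormal vectors in $\mathbb R^d$ and $\sigma>0$. The Gauss–Hermite estimator of the directional Gaussian smoothing (DGS) gradient of $F:\mathbb R^d\to\mathbb R$ is $$\widetilde\nabla^M_{\sigma}[F](x)=\sum_{i=1}^d\Big(\frac{1}{\sqrt\pi\,\sigma}\sum_{m=1}^M w_m\,F\big(x+\sqrt2\,\sigma v_m\xi_i\big)\sqrt2\,v_m\Big)\xi_i .$$ *Statement.* Let $L>0$, $\alpha>0$, $\gamma_1\ge 0$. There is a constant $C>0$, depending only on $L,\alpha,\gamma_1$ (in particular not on $M$, $\sigma$, $d$, $\tau$, nor on the iterates), such that the following holds for all $d$, all orthonormal $\xi_1,\dots,\xi_d\in\mathbb R^d$, all $\tau>0$ and all $M\ge 2$. Let $F=\varphi+\varepsilon$,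 where $\varphi:\mathbb R^d\to\mathbb R$ is continuously differentiable with $\|\nabla\varphi(x)-\nabla\varphi(y)\|\le L\|x-y\|$ and $\varphi(y)\ge\varphi(x)+\langle\nabla\varphi(x),y-x\rangle+\frac{\tau}{2}\|y-x\|^2$ for all $x,y\in\mathbb R^d$, and where $\varepsilon:\mathbb R^d\to\mathbb R$ is such that for every $x\in\mathbb R^d$ and every $i$ the cross-section $\eta(y)=\varepsilon(x+y\xi_i)$, $y\in\mathbb R$, is continuously differentiable, periodic with period $1/\alpha$, and satisfies $|\eta'(y)|\le\gamma_1$ for all $y$. Let $x^*$ be the global minimizer of $\varphi$. For $\sigma>0$ put $$\delta_\sigma=\Big(\frac{4}{\tau^2}+\frac{1}{4L\tau}\Big)\bigg(\frac{C\pi(M!)^2d}{4^M((2M)!)^2}\sigma^{4M-2}+48L^2d\sigma^2+\frac{3\gamma_1^2d}{2e^{4\pi^2\alpha^2\sigma^2}}\Big(1+\frac{1}{8\pi\alpha^2\sigma^2}\Big)\bigg).$$ 1. For every $\sigma>0$, every sequence with $x_{t+1}=x_t-\lambda\,\widetilde\nabla^M_{\sigma}[F](x_t)$, $\lambda=\frac{1}{16L}$,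 and arbitrary $x_0\in\mathbb R^d$, satisfies for all $t\ge0$ $$\|x_{t+1}-x^*\|^2\le\Big(1-\frac{\tau}{32L}\Big)^{t+1}\|x_0-x^*\|^2+\delta_\sigma .$$ 2. (High frequency.) If $\pi\alpha\gamma_1>2\sqrt2\,L$, then with $\ell=\log\frac{\pi\alpha\gamma_1}{2\sqrt2\,L}$ and $\sigma=\frac{1}{\pi\alpha\sqrt2}\,\ell^{1/2}$, $$\delta_\sigma\le\Big(\frac{4}{\tau^2}+\frac{1}{4L\tau}\Big)\bigg[\frac{C\pi(M!)^2d}{4^M((2M)!)^2}\sigma^{4M-2}+\frac{30L^2d}{\pi^2\alpha^2}\big(\ell+\ell^{-1}\big)\bigg].$$ 3. (Low frequency.) If $\pi\alpha\gamma_1\le 2\sqrt2\,L$, then with $\sigma=\frac1\alpha$, $$\delta_\sigma\le\Big(\frac{4}{\tau^2}+\frac{1}{4L\tau}\Big)\bigg[\frac{C\pi(M!)^2d}{4^M((2M)!)^2}\sigma^{4M-2}+\frac{64L^2d}{\alpha^2}\bigg].$$ -/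

import Mathlib

noncomputable section

namespace DGS

/-- The physicists' Hermite polynomial `H_n(x) = 2^{n/2} He_n(√2 x)`, where `He_n` is Mathlib's
(probabilists') Hermite polynomial. These are orthogonal for the weight `exp (-x ^ 2)`. -/
def hermiteH (n : ℕ) : Polynomial ℝ :=
  Polynomial.C (√2 ^ n) *
    (((Polynomial.hermite n).map (Int.castRingHom ℝ)).comp (Polynomial.C √2 * Polynomial.X))

/-- The nodes of the `M`-point Gauss–Hermite rule: the (real, simple) roots of `H_M`. -/
def ghNodes (M : ℕ) : Finset ℝ := (hermiteH M).roots.toFinset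

/-- The weight of the `M`-point Gauss–Hermite rule at the node `v`: the integral of the Lagrange
basis polynomial of the node `v` against `exp (-x ^ 2)`. -/
def ghWeight (M : ℕ) (v : ℝ) : ℝ :=
  ∫ x : ℝ, (Lagrange.basis (ghNodes M) id v).eval x * Real.exp (-x ^ 2)

variable {d : ℕ}

/-- The Gauss–Hermite estimator of the derivative at `0` of the Gaussian smoothing, with radius
`σ`, of the cross-section `y ↦ F (x + y ξ)`. -/
def ghDirDeriv (M : ℕ) (σ : ℝ) (F : EuclideanSpace ℝ (Fin d) → ℝ)
    (x ξ : EuclideanSpace ℝ (Fin d)) : ℝ :=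
  1 / (√Real.pi * σ) *
    ∑ v ∈ ghNodes M, ghWeight M v * F (x + (√2 * σ * v) • ξ) * (√2 * v)

/-- The Gauss–Hermite estimator of the directional-Gaussian-smoothing (DGS) gradient of `F` at `x`:
the vector whose component along the direction `ξ i` is the estimator `ghDirDeriv`. -/
def ghGradient (M : ℕ) (σ : ℝ) (ξ : Fin d → EuclideanSpace ℝ (Fin d))
    (F : EuclideanSpace ℝ (Fin d) → ℝ) (x : EuclideanSpace ℝ (Fin d)) :
    EuclideanSpace ℝ (Fin d) :=
  ∑ i, ghDirDeriv M σ F x (ξ i) • ξ i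

/-- The sequence `x` is generated by DGS gradient descent for `F` with fixed step size `lam` and
fixed smoothing radius `σ`. -/
def IsDGSDescent (lam : ℝ) (M : ℕ) (σ : ℝ) (ξ : Fin d → EuclideanSpace ℝ (Fin d))
    (F : EuclideanSpace ℝ (Fin d) → ℝ) (x : ℕ → EuclideanSpace ℝ (Fin d)) : Prop :=
  ∀ t, x (t + 1) = x t - lam • ghGradient M σ ξ F (x t)

/-- `φ` is continuously differentiable with `L`-Lipschitz gradient. -/
def IsSmooth (L : ℝ) (φ : EuclideanSpace ℝ (Fin d) → ℝ) : Prop :=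
  ContDiff ℝ 1 φ ∧ ∀ x y, ‖gradient φ x - gradient φ y‖ ≤ L * ‖x - y‖

/-- The first-order form of strong convexity with parameter `τ`. -/
def IsStronglyConvex (τ : ℝ) (φ : EuclideanSpace ℝ (Fin d) → ℝ) : Prop :=
  ∀ x y, φ x + inner ℝ (gradient φ x) (y - x) + τ / 2 * ‖y - x‖ ^ 2 ≤ φ y

/-- Every cross-section `η(y) = ε (x + y ξ_i)` of the noise is continuously differentiable,
has period `1 / α`, and satisfies `|η'| ≤ γ₁`. -/
def IsPeriodicNoise (α γ₁ : ℝ) (ξ : Fin d → EuclideanSpace ℝ (Fin d))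
    (ε : EuclideanSpace ℝ (Fin d) → ℝ) : Prop :=
  ∀ (x : EuclideanSpace ℝ (Fin d)) (i : Fin d),
    Function.Periodic (fun y : ℝ => ε (x + y • ξ i)) (1 / α) ∧
    ContDiff ℝ 1 (fun y : ℝ => ε (x + y • ξ i)) ∧
    ∀ y : ℝ, |deriv (fun y : ℝ => ε (x + y • ξ i)) y| ≤ γ₁

/-- The Gauss–Hermite quadrature error term
`C π (M!)² d σ^(4M-2) / (4^M ((2M)!)²)`. -/
def ghError (C : ℝ) (d M : ℕ) (σ : ℝ) : ℝ :=
  C * Real.pi * (M.factorial : ℝ) ^ 2 * d / (4 ^ M * ((2 * M).factorial : ℝ) ^ 2) *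
    σ ^ (4 * M - 2)

/-- The squared radius `δ_σ` of the neighbourhood of convergence. -/
def delta (C L τ α γ₁ : ℝ) (d M : ℕ) (σ : ℝ) : ℝ :=
  (4 / τ ^ 2 + 1 / (4 * L * τ)) *
    (ghError C d M σ + 48 * L ^ 2 * d * σ ^ 2 +
      3 * γ₁ ^ 2 * d / (2 * Real.exp (4 * Real.pi ^ 2 * α ^ 2 * σ ^ 2)) *
        (1 + 1 / (8 * Real.pi * α ^ 2 * σ ^ 2)))

end DGS

end

namespace DGS

open Polynomial

/-! The scheme is gradient descent on `φ` with an inexact gradient. The squared error splits over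
the orthonormal directions, and in each direction into a smooth part and a noise part.

On `φ` the error is O(Lσ): the quadrature has nonnegative weights and the correct low moments, so it
reproduces the first-order Taylor part and only the remainder, of size L|h|², contributes.

On the noise the estimator is a Fourier multiplier. Writing the cross-section as a Fourier series
and applying Cauchy–Schwarz and Parseval to its derivative bounds the squared estimator by γ² times
the sum over n ≠ 0 of (|`ghFourier M β`|/|β|)², where β = 2πnασ. Exact smoothing would give
exp(-β²/2) for the ratio; the quadrature differs from it by a Taylor remainder that vanishes as M
grows, for β in a bounded set.

The constant C comes from a case split that is uniform in M and σ. For small σ the trivial bound γ²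
is absorbed by the exponential term, and for σ > γ/(8L) by the L²σ² term. On the remaining compact
range of σ, all M beyond some M₀ enjoy nearly Gaussian damping, and the finitely many smaller M are
covered by taking C large. Hence C depends only on L, α and γ.

Finally, an exact gradient step contracts by more than is claimed; Young's inequality spends the
surplus on the error, and the resulting linear recursion is summed. -/

/-! ### Gaussian moments of polynomials. -/

theorem integrable_eval_mul_exp_neg_sq (p : ℝ[X]) :
    MeasureTheory.Integrable fun x : ℝ => p.eval x * Real.exp (-x ^ 2) := by
  induction p using Polynomial.induction_on' with
  | add p q hp hq =>
    simpa [add_mul] using! hp.add hq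
  | monomial n a =>
    have h := (integrable_rpow_mul_exp_neg_mul_sq (b := 1) one_pos (s := n)
      (by linarith [n.cast_nonneg (α := ℝ)])).const_mul a
    simpa [mul_assoc] using h

/-- Integration of polynomials against the weight `exp (-x ^ 2)`. -/
noncomputable def gaussInt : ℝ[X] →ₗ[ℝ] ℝ where
  toFun p := ∫ x : ℝ, p.eval x * Real.exp (-x ^ 2)
  map_add' p q := by
    simp only [eval_add, add_mul]
    exact MeasureTheory.integral_add (integrable_eval_mul_exp_neg_sq p)
      (integrable_eval_mul_exp_neg_sq q)
  map_smul' c p := by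
    simp only [eval_smul, smul_eq_mul, mul_assoc, RingHom.id_apply]
    exact MeasureTheory.integral_const_mul _ _

theorem gaussInt_apply (p : ℝ[X]) : gaussInt p = ∫ x : ℝ, p.eval x * Real.exp (-x ^ 2) := rfl

theorem gaussInt_one : gaussInt 1 = √Real.pi := by
  simpa [gaussInt_apply] using integral_gaussian 1

/-- Integration by parts against the Gaussian weight. -/
theorem gaussInt_derivative (p : ℝ[X]) : gaussInt (derivative p) = gaussInt (2 * X * p) := by
  have hd : ∀ x : ℝ, HasDerivAt (fun x => p.eval x * Real.exp (-x ^ 2))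
      ((derivative p - 2 * X * p).eval x * Real.exp (-x ^ 2)) x := fun x => by
    have h := (p.hasDerivAt x).mul ((hasDerivAt_pow 2 x).neg.exp)
    refine h.congr_deriv ?_
    simp
    ring
  have h := MeasureTheory.integral_eq_zero_of_hasDerivAt_of_integrable hd
    (integrable_eval_mul_exp_neg_sq _) (integrable_eval_mul_exp_neg_sq p)
  rw [← gaussInt_apply, map_sub] at h
  exact sub_eq_zero.mp h

theorem gaussInt_pos_of_nonneg {p : ℝ[X]} (hp : ∀ x, 0 ≤ p.eval x) (h0 : p ≠ 0) :
    0 < gaussInt p := by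
  obtain ⟨x, hx⟩ : ∃ x, p.eval x ≠ 0 := by
    by_contra! h
    exact h0 (Polynomial.funext fun x => by simpa using h x)
  rw [gaussInt_apply]
  exact MeasureTheory.integral_pos_of_integrable_nonneg_nonzero (x := x) (by fun_prop)
    (integrable_eval_mul_exp_neg_sq p) (fun y => mul_nonneg (hp y) (Real.exp_pos _).le)
    (mul_ne_zero hx (Real.exp_pos _).ne')

theorem gaussInt_nonneg {p : ℝ[X]} (hp : ∀ x, 0 ≤ p.eval x) : 0 ≤ gaussInt p :=
  MeasureTheory.integral_nonneg fun x => mul_nonneg (hp x) (Real.exp_pos _).le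

theorem gaussInt_X_pow_add_two (k : ℕ) :
    gaussInt (X ^ (k + 2)) = (k + 1) / 2 * gaussInt (X ^ k) := by
  have h := gaussInt_derivative (X ^ (k + 1))
  have e : (derivative (X ^ (k + 1)) : ℝ[X]) = ((k : ℝ) + 1) • X ^ k := by
    rw [derivative_X_pow, smul_eq_C_mul]; simp
  have e' : (2 * X * X ^ (k + 1) : ℝ[X]) = (2 : ℝ) • X ^ (k + 2) := by
    rw [smul_eq_C_mul, map_ofNat]; ring
  rw [e, e', map_smul, map_smul, smul_eq_mul, smul_eq_mul] at h
  linarith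

theorem gaussInt_X_pow_odd (k : ℕ) : gaussInt (X ^ (2 * k + 1)) = 0 := by
  induction k with
  | zero =>
    have h := gaussInt_derivative 1
    have e' : (2 * X * 1 : ℝ[X]) = (2 : ℝ) • X ^ 1 := by
      rw [smul_eq_C_mul, map_ofNat]; ring
    rw [e', map_smul] at h
    simpa using h.symm
  | succ k ih => rw [show 2 * (k + 1) + 1 = 2 * k + 1 + 2 by ring, gaussInt_X_pow_add_two, ih, mul_zero]

theorem gaussInt_X_pow_even (k : ℕ) :
    gaussInt (X ^ (2 * k)) = √Real.pi * (2 * k).factorial / (4 ^ k * k.factorial) := by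
  induction k with
  | zero => simp [gaussInt_one]
  | succ k ih =>
    rw [show 2 * (k + 1) = 2 * k + 2 by ring, gaussInt_X_pow_add_two, ih]
    simp only [Nat.factorial_succ]
    push_cast
    field_simp
    ring

/-! ### Hermite polynomials: orthogonality and real simple roots. -/

theorem hermiteH_succ (n : ℕ) :
    hermiteH (n + 1) = 2 * X * hermiteH n - derivative (hermiteH n) := by
  have h2 : (C √2 * C √2 : ℝ[X]) = 2 := by
    rw [← C_mul, Real.mul_self_sqrt zero_le_two, map_ofNat]
  simp only [hermiteH, hermite_succ, Polynomial.map_sub, Polynomial.map_mul, map_X, sub_comp,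
    mul_comp, X_comp, derivative_mul, derivative_C, derivative_comp, zero_mul, zero_add, derivative_X, derivative_map,
    pow_succ, C_mul, mul_one]
  linear_combination (X * C (√2 ^ n) * ((hermite n).map (Int.castRingHom ℝ)).comp (C √2 * X)) * h2

theorem natDegree_hermiteH (n : ℕ) : (hermiteH n).natDegree = n := by
  have h2 : √2 ≠ 0 := by positivity
  rw [hermiteH, natDegree_C_mul (pow_ne_zero _ h2), natDegree_comp, natDegree_C_mul_X _ h2, mul_one,
    (hermite_monic n).natDegree_map, natDegree_hermite]

theorem hermiteH_ne_zero (n : ℕ) : hermiteH n ≠ 0 := by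
  rcases n with _ | n
  · simp [hermiteH]
  · exact ne_zero_of_natDegree_gt (n := 0) (by rw [natDegree_hermiteH]; omega)

/-- The operator `2 * X - derivative` that raises the Hermite index is the adjoint of
differentiation for the Gaussian weight. Orthogonality to lower degrees follows. -/
theorem gaussInt_hermiteH_mul (n : ℕ) (p : ℝ[X]) :
    gaussInt (hermiteH n * p) = gaussInt (derivative^[n] p) := by
  induction n generalizing p with
  | zero => simp [hermiteH]
  | succ n ih =>
    rw [Function.iterate_succ_apply, ← ih, hermiteH_succ,
      show (2 * X * hermiteH n - derivative (hermiteH n)) * p =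
        2 * X * (hermiteH n * p) - derivative (hermiteH n) * p by ring, map_sub,
      ← gaussInt_derivative, derivative_mul, map_add]
    ring

theorem gaussInt_hermiteH_mul_eq_zero {n : ℕ} {p : ℝ[X]} (hp : p.degree < n) :
    gaussInt (hermiteH n * p) = 0 := by
  rw [gaussInt_hermiteH_mul, iterate_derivative_eq_zero_of_degree_lt hp, map_zero]

/-- If H_n = q p, then p has degree below n, so H_n is orthogonal to p; yet H_n p = q p² has
positive integral. This excludes both non-real roots and double roots. -/
theorem not_nonneg_quadratic_dvd_hermiteH {n : ℕ} {q : ℝ[X]} (hq : ∀ x, 0 ≤ q.eval x)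
    (hd : q.natDegree = 2) : ¬ q ∣ hermiteH n := by
  rintro ⟨p, hp⟩
  have h0 := hermiteH_ne_zero n
  have hp0 : p ≠ 0 := fun h => h0 (by rw [hp, h, mul_zero])
  have hq0 : q ≠ 0 := fun h => h0 (by rw [hp, h, zero_mul])
  have hn := natDegree_hermiteH n
  rw [hp, natDegree_mul hq0 hp0, hd] at hn
  have h := gaussInt_hermiteH_mul_eq_zero (n := n) (p := p)
    (by rw [degree_eq_natDegree hp0]; exact_mod_cast (by omega))
  rw [hp, mul_assoc] at h
  refine (gaussInt_pos_of_nonneg (p := q * (p * p)) (fun x => ?_) (by simp [hp0, hq0])).ne' h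
  simpa using mul_nonneg (hq x) (mul_self_nonneg _)

/-- An irreducible factor with a non-real root z is divisible by X² - 2 Re(z) X + |z|², which is
nonnegative on the real line. -/
theorem hermiteH_splits (n : ℕ) : (hermiteH n).Splits := by
  obtain ⟨u, hu⟩ := UniqueFactorizationMonoid.factors_prod (hermiteH_ne_zero n)
  rw [← hu]
  refine (Splits.multisetProd fun g hg => ?_).mul u.isUnit.splits
  have hirr := UniqueFactorizationMonoid.irreducible_of_factor g hg
  have hdvd := UniqueFactorizationMonoid.dvd_of_mem_factors hg
  obtain ⟨z, hz⟩ := IsAlgClosed.exists_aeval_eq_zero ℂ g (degree_pos_of_irreducible hirr).ne'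
  by_cases him : z.im = 0
  · obtain ⟨a, rfl⟩ : ∃ a : ℝ, (a : ℂ) = z := ⟨z.re, Complex.ext rfl him.symm⟩
    refine Splits.of_degree_eq_one (degree_eq_one_of_irreducible_of_root hirr (x := a) ?_)
    have h : (aeval (algebraMap ℝ ℂ a)) g = 0 := hz
    rw [aeval_algebraMap_apply] at h
    simpa [IsRoot.def] using h
  · refine absurd ((quadratic_dvd_of_aeval_eq_zero_im_ne_zero g hz him).trans hdvd)
      (not_nonneg_quadratic_dvd_hermiteH (fun x => ?_) (by compute_degree!))
    have h := Complex.sq_norm z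
    rw [Complex.normSq_apply] at h
    simp only [eval_add, eval_sub, eval_pow, eval_X, eval_mul, eval_C, h]
    nlinarith [sq_nonneg (x - z.re), sq_nonneg z.im]

theorem card_ghNodes (M : ℕ) : (ghNodes M).card = M := by
  have hnd : (hermiteH M).roots.Nodup := by
    rw [Multiset.nodup_iff_count_le_one]
    intro a
    rw [count_roots]
    by_contra! h
    refine not_nonneg_quadratic_dvd_hermiteH (n := M) (q := (X - C a) ^ 2) (fun x => ?_) ?_ ?_
    · simpa using sq_nonneg _
    · simp [natDegree_pow]
    · exact (le_rootMultiplicity_iff (hermiteH_ne_zero M)).1 h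
  rw [ghNodes, Multiset.toFinset_card_of_nodup hnd, splits_iff_card_roots.1 (hermiteH_splits M),
    natDegree_hermiteH]

/-! ### Gauss–Hermite quadrature: exactness and positivity. -/

theorem gaussInt_eq_sum_of_degree_lt {M : ℕ} {p : ℝ[X]} (hp : p.degree < M) :
    gaussInt p = ∑ v ∈ ghNodes M, ghWeight M v * p.eval v := by
  have h := Lagrange.eq_interpolate (s := ghNodes M) (v := id) (f := p) Function.injective_id.injOn
    (by rwa [card_ghNodes])
  conv_lhs => rw [h, Lagrange.interpolate_apply, map_sum]
  refine Finset.sum_congr rfl fun v _ => ?_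
  rw [← smul_eq_C_mul, map_smul, smul_eq_mul, mul_comm]
  rfl

/-- The Gauss–Hermite rule with `M` nodes is exact on polynomials of degree less than `2 M`. -/
theorem gaussInt_eq_sum {M : ℕ} {p : ℝ[X]} (hp : p.natDegree < 2 * M) :
    gaussInt p = ∑ v ∈ ghNodes M, ghWeight M v * p.eval v := by
  have h0 := hermiteH_ne_zero M
  have hmod : (p % hermiteH M).degree < M := by
    have := degree_mod_lt p h0
    rwa [degree_eq_natDegree h0, natDegree_hermiteH] at this
  have hdiv : (p / hermiteH M).degree < M := by
    by_cases hz : p / hermiteH M = 0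
    · rw [hz, degree_zero]; exact WithBot.bot_lt_coe _
    have h := natDegree_mul h0 hz
    have hsub : hermiteH M * (p / hermiteH M) = p - p % hermiteH M :=
      eq_sub_of_add_eq (EuclideanDomain.div_add_mod p (hermiteH M))
    have h2 := natDegree_sub_le p (p % hermiteH M)
    have h3 := natDegree_le_of_degree_le hmod.le
    rw [hsub, natDegree_hermiteH] at h
    rw [degree_eq_natDegree hz]
    exact_mod_cast (by omega)
  conv_lhs => rw [← EuclideanDomain.div_add_mod p (hermiteH M), map_add,
    gaussInt_hermiteH_mul_eq_zero hdiv, zero_add, gaussInt_eq_sum_of_degree_lt hmod]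
  refine Finset.sum_congr rfl fun v hv => ?_
  have hv : (hermiteH M).eval v = 0 := by
    simpa [ghNodes, h0] using hv
  conv_rhs => rw [← EuclideanDomain.div_add_mod p (hermiteH M), eval_add, eval_mul, hv, zero_mul,
    zero_add]

/-- The square of a Lagrange basis polynomial has degree 2M - 2, so the rule is exact on it and
returns precisely the weight. -/
theorem ghWeight_nonneg {M : ℕ} {v : ℝ} (hv : v ∈ ghNodes M) : 0 ≤ ghWeight M v := by
  have hd := Lagrange.natDegree_basis (s := ghNodes M) (v := id) Function.injective_id.injOn hv
  have hM : 0 < M := card_ghNodes M ▸ Finset.card_pos.2 ⟨v, hv⟩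
  have h := gaussInt_eq_sum (M := M)
    (p := Lagrange.basis (ghNodes M) id v * Lagrange.basis (ghNodes M) id v)
    (by
      refine natDegree_mul_le.trans_lt ?_
      rw [hd, card_ghNodes]; omega)
  rw [Finset.sum_eq_single_of_mem v hv] at h
  · have e := Lagrange.eval_basis_self (s := ghNodes M) (v := id) Function.injective_id.injOn hv
    rw [id] at e
    rw [eval_mul, e, mul_one, mul_one] at h
    rw [← h]
    exact gaussInt_nonneg fun x => by simpa using mul_self_nonneg _
  · intro u hu huv
    have e := Lagrange.eval_basis_of_ne (s := ghNodes M) (v := id) huv.symm hu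
    rw [id] at e
    rw [eval_mul, e, mul_zero, mul_zero]

theorem sum_ghWeight_mul_pow {M k : ℕ} (hk : k < 2 * M) :
    ∑ v ∈ ghNodes M, ghWeight M v * v ^ k = gaussInt (X ^ k) := by
  rw [gaussInt_eq_sum (M := M) (by simpa using hk)]
  simp

/-! ### The quadrature as a Fourier multiplier. -/

/-- Taylor's bound for the complex exponential in the left half-plane. -/
theorem norm_exp_sub_sum_le_of_re_nonpos {z : ℂ} (hz : z.re ≤ 0) (n : ℕ) :
    ‖Complex.exp z - ∑ l ∈ Finset.range n, z ^ l / (l.factorial : ℂ)‖ ≤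
      ‖z‖ ^ n / n.factorial := by
  -- Working on the whole segment from 0 to z lets the induction integrate: the t-derivative of the
  -- remainder of order n + 1 is z times that of order n.
  suffices h : ∀ t ∈ Set.Icc (0 : ℝ) 1,
      ‖Complex.exp (t * z) - ∑ l ∈ Finset.range n, ((t : ℂ) * z) ^ l / (l.factorial : ℂ)‖ ≤
        (t * ‖z‖) ^ n / n.factorial by
    simpa using h 1 (by simp)
  induction n with
  | zero =>
    intro t ht
    simp only [Finset.range_zero, Finset.sum_empty, sub_zero, pow_zero, Nat.factorial_zero,
      Nat.cast_one, div_one, Complex.norm_exp, Complex.re_ofReal_mul]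
    exact Real.exp_le_one_iff.2 (mul_nonpos_of_nonneg_of_nonpos ht.1 hz)
  | succ n ih =>
    have hd : ∀ t : ℝ, HasDerivAt (fun t : ℝ =>
        Complex.exp (t * z) - ∑ l ∈ Finset.range (n + 1), ((t : ℂ) * z) ^ l / (l.factorial : ℂ))
        (z * (Complex.exp (t * z) -
          ∑ l ∈ Finset.range n, ((t : ℂ) * z) ^ l / (l.factorial : ℂ))) t := fun t => by
      have h1 : HasDerivAt (fun t : ℝ => (t : ℂ) * z) z t := by
        simpa using (Complex.ofRealCLM.hasDerivAt (x := t)).mul_const z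
      have h2 : HasDerivAt (fun t : ℝ => ∑ l ∈ Finset.range (n + 1),
          ((t : ℂ) * z) ^ l / (l.factorial : ℂ))
          (∑ l ∈ Finset.range (n + 1),
            ((l : ℂ) * ((t : ℂ) * z) ^ (l - 1) * z) / (l.factorial : ℂ)) t :=
        HasDerivAt.fun_sum fun l _ => (h1.pow l).div_const _
      refine (h1.cexp.sub h2).congr_deriv ?_
      rw [Finset.sum_range_succ', mul_sub, Finset.mul_sum]
      simp only [Nat.cast_zero, zero_mul, zero_div, add_zero, Nat.add_sub_cancel,
        Nat.factorial_succ]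
      congr 1
      · ring
      · refine Finset.sum_congr rfl fun l _ => ?_
        have : (l.factorial : ℂ) ≠ 0 := by exact_mod_cast l.factorial_ne_zero
        have : (l : ℂ) + 1 ≠ 0 := by exact_mod_cast l.succ_ne_zero
        push_cast
        field_simp
    have hB : ∀ t : ℝ, HasDerivAt (fun t : ℝ => (t * ‖z‖) ^ (n + 1) / (n + 1).factorial)
        (‖z‖ * ((t * ‖z‖) ^ n / n.factorial)) t := fun t => by
      refine ((((hasDerivAt_id t).mul_const ‖z‖).pow (n + 1)).div_const _).congr_deriv ?_
      have : (n.factorial : ℝ) ≠ 0 := by exact_mod_cast n.factorial_ne_zero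
      have : (n : ℝ) + 1 ≠ 0 := by exact_mod_cast n.succ_ne_zero
      simp only [Nat.factorial_succ, id, Nat.add_sub_cancel]
      push_cast
      field_simp
    intro t ht
    refine image_norm_le_of_norm_deriv_right_le_deriv_boundary (a := 0) (b := 1)
      (fun x _ => (hd x).continuousAt.continuousWithinAt)
      (fun x _ => (hd x).hasDerivWithinAt) (by simp [Finset.sum_range_succ']) hB
      (fun x hx => ?_) ht
    rw [norm_mul]
    exact mul_le_mul_of_nonneg_left (ih x (Set.Ico_subset_Icc_self hx)) (norm_nonneg z)

/-- The Gauss–Hermite approximation of the derivative at `0` of the function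
`y ↦ exp (i β y)` smoothed with radius `1`. -/
noncomputable def ghFourier (M : ℕ) (β : ℝ) : ℂ :=
  ∑ v ∈ ghNodes M, ((√2 / √Real.pi * (ghWeight M v * v) : ℝ) : ℂ) *
    Complex.exp (((√2 * β * v : ℝ) : ℂ) * Complex.I)

/-- From √2|v| ≤ v² + 1/2 and the moments of order 0 and 2. Uniform in M, this supplies the summable
majorant in 1/n² for dominated convergence. -/
theorem norm_ghFourier_le_one {M : ℕ} (hM : 2 ≤ M) (β : ℝ) : ‖ghFourier M β‖ ≤ 1 := by
  have hpi : 0 < √Real.pi := Real.sqrt_pos.2 Real.pi_pos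
  have h2 : √2 * √2 = 2 := Real.mul_self_sqrt zero_le_two
  have hs : ∑ v ∈ ghNodes M, (ghWeight M v * v ^ 2 + 1 / 2 * (ghWeight M v * v ^ 0)) =
      √Real.pi := by
    rw [Finset.sum_add_distrib, ← Finset.mul_sum, sum_ghWeight_mul_pow (by omega),
      sum_ghWeight_mul_pow (by omega), gaussInt_X_pow_add_two, pow_zero, gaussInt_one]
    push_cast; ring
  calc ‖ghFourier M β‖ ≤ ∑ v ∈ ghNodes M,
        (ghWeight M v * v ^ 2 + 1 / 2 * (ghWeight M v * v ^ 0)) / √Real.pi := by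
        refine (norm_sum_le _ _).trans (Finset.sum_le_sum fun v hv => ?_)
        have hw := ghWeight_nonneg hv
        rw [norm_mul, Complex.norm_exp_ofReal_mul_I, mul_one, Complex.norm_real, Real.norm_eq_abs,
          abs_mul, abs_mul, abs_of_nonneg hw, abs_of_nonneg (by positivity), div_mul_eq_mul_div]
        gcongr
        rw [pow_zero]
        have : √2 * |v| ≤ v ^ 2 + 1 / 2 := by
          nlinarith [sq_nonneg (√2 * |v| - 1), sq_abs v]
        nlinarith
    _ = 1 := by rw [← Finset.sum_div, hs, div_self hpi.ne']

theorem gaussInt_X_pow_even_div (i : ℕ) :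
    √2 / √Real.pi * (√2 ^ (2 * i + 1) * gaussInt (X ^ (2 * i + 2)) / (2 * i + 1).factorial) =
      (1 / 2) ^ i / i.factorial := by
  have hpi : √Real.pi ≠ 0 := (Real.sqrt_pos.2 Real.pi_pos).ne'
  have h2 : √2 ^ 2 = 2 := Real.sq_sqrt zero_le_two
  have h := gaussInt_X_pow_even (i + 1)
  rw [show 2 * (i + 1) = 2 * i + 1 + 1 by ring] at h
  rw [h, Nat.factorial_succ (2 * i + 1), Nat.factorial_succ i, pow_succ √2, pow_mul, h2]
  have := (2 * i + 1).factorial_pos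
  have := i.factorial_pos
  rw [show (4 : ℝ) ^ (i + 1) = 4 * (2 ^ i * 2 ^ i) by rw [pow_succ, ← mul_pow]; norm_num; ring,
    div_pow, one_pow]
  push_cast
  field_simp
  rw [h2]
  ring

/-- Expand the exponential to order 2j. Exact moments turn the Taylor polynomial into iβ times a
partial sum of exp(-β²/2), the odd moments vanishing; the extra factor v makes the remainder a
moment of order 2j + 2, still exact. -/
theorem norm_ghFourier_sub_le {M j : ℕ} (hj : 2 * j + 2 < 2 * M) (β : ℝ) :
    ‖ghFourier M β - β * Complex.I *
        ∑ i ∈ Finset.range j, (-(β : ℂ) ^ 2 / 2) ^ i / (i.factorial : ℂ)‖ ≤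
      |β| * ((β ^ 2 / 2) ^ j / j.factorial) := by
  have key : ∑ v ∈ ghNodes M, ((√2 / √Real.pi * (ghWeight M v * v) : ℝ) : ℂ) *
      ∑ l ∈ Finset.range (2 * j + 1), (((√2 * β * v : ℝ) : ℂ) * Complex.I) ^ l / (l.factorial : ℂ) =
      β * Complex.I * ∑ i ∈ Finset.range j, (-(β : ℂ) ^ 2 / 2) ^ i / (i.factorial : ℂ) := by
    have hmom : ∀ l < 2 * j + 1, ∑ v ∈ ghNodes M,
        ((√2 / √Real.pi * (ghWeight M v * v) : ℝ) : ℂ) *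
          ((((√2 * β * v : ℝ) : ℂ) * Complex.I) ^ l / (l.factorial : ℂ)) =
        ((√2 / √Real.pi * (√2 ^ l * gaussInt (X ^ (l + 1)) / l.factorial) : ℝ) : ℂ) *
          (β * Complex.I) ^ l := fun l hl => by
      rw [← sum_ghWeight_mul_pow (M := M) (by omega)]
      push_cast
      rw [Finset.mul_sum, Finset.sum_div, Finset.mul_sum, Finset.sum_mul]
      refine Finset.sum_congr rfl fun v _ => ?_
      ring
    simp only [Finset.mul_sum]
    rw [Finset.sum_comm, Finset.sum_congr rfl fun l hl => hmom l (Finset.mem_range.1 hl)]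
    clear hmom hj
    induction j with
    | zero =>
      have := gaussInt_X_pow_odd 0
      simp at this
      simp [this]
    | succ j ih =>
      rw [show 2 * (j + 1) + 1 = 2 * j + 1 + 1 + 1 by ring, Finset.sum_range_succ,
        Finset.sum_range_succ, ih, Finset.sum_range_succ, gaussInt_X_pow_even_div,
        show 2 * j + 1 + 1 + 1 = 2 * (j + 1) + 1 by ring, gaussInt_X_pow_odd]
      have hI : (β * Complex.I : ℂ) ^ (2 * j + 1) = β * Complex.I * (-(β : ℂ) ^ 2) ^ j := by
        rw [pow_succ, pow_mul, mul_pow, Complex.I_sq]; ring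
      rw [hI]
      push_cast
      rw [div_pow, div_pow]
      ring
  rw [← key, ghFourier, ← Finset.sum_sub_distrib]
  calc _ ≤ ∑ v ∈ ghNodes M, √2 / √Real.pi * (√2 ^ (2 * j + 1) *
          (ghWeight M v * v ^ (2 * j + 2)) / (2 * j + 1).factorial) * |β| ^ (2 * j + 1) := by
        refine (norm_sum_le _ _).trans (Finset.sum_le_sum fun v hv => ?_)
        have hw := ghWeight_nonneg hv
        have hT := norm_exp_sub_sum_le_of_re_nonpos
          (z := ((√2 * β * v : ℝ) : ℂ) * Complex.I) (by simp) (2 * j + 1)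
        rw [← mul_sub, norm_mul, Complex.norm_real, Real.norm_eq_abs,
          abs_mul, abs_mul, abs_of_nonneg hw, abs_of_nonneg (by positivity : 0 ≤ √2 / √Real.pi)]
        refine (mul_le_mul_of_nonneg_left hT (by positivity)).trans_eq ?_
        rw [norm_mul, Complex.norm_I, mul_one, Complex.norm_real, Real.norm_eq_abs, abs_mul,
          abs_mul, abs_of_nonneg (Real.sqrt_nonneg 2), mul_pow, mul_pow,
          ← Even.pow_abs (n := 2 * j + 2) ⟨j + 1, by ring⟩ v]
        ring
    _ = |β| * ((β ^ 2 / 2) ^ j / j.factorial) := by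
        rw [← Finset.sum_mul, ← Finset.mul_sum, ← Finset.sum_div, ← Finset.mul_sum,
          sum_ghWeight_mul_pow hj, gaussInt_X_pow_even_div, pow_succ, pow_mul, sq_abs, div_pow,
          div_pow]
        ring

/-- The factor 2 counts two remainders: that of the quadrature and that of the partial sum of
exp(-β²/2). -/
theorem norm_ghFourier_le {M j : ℕ} (hj : 2 * j + 2 < 2 * M) (β : ℝ) :
    ‖ghFourier M β‖ ≤ |β| * (Real.exp (-(β ^ 2 / 2)) + 2 * ((β ^ 2 / 2) ^ j / j.factorial)) := by
  have h1 := norm_ghFourier_sub_le hj β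
  have h2 := norm_exp_sub_sum_le_of_re_nonpos (z := ((-(β ^ 2 / 2) : ℝ) : ℂ))
    (by rw [Complex.ofReal_re]; nlinarith [sq_nonneg β]) j
  rw [Complex.norm_real, Real.norm_eq_abs, abs_neg, abs_of_nonneg (by positivity)] at h2
  have h3 : ‖Complex.exp ((-(β ^ 2 / 2) : ℝ) : ℂ)‖ = Real.exp (-(β ^ 2 / 2)) := by
    rw [Complex.norm_exp, Complex.ofReal_re]
  have e : ((-(β ^ 2 / 2) : ℝ) : ℂ) = -(β : ℂ) ^ 2 / 2 := by push_cast; ring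
  rw [e] at h2 h3
  set A := ∑ i ∈ Finset.range j, (-(β : ℂ) ^ 2 / 2) ^ i / (i.factorial : ℂ)
  have h4 : ‖A‖ ≤ Real.exp (-(β ^ 2 / 2)) + (β ^ 2 / 2) ^ j / j.factorial := by
    rw [← h3]
    refine (norm_le_norm_add_norm_sub _ _).trans (add_le_add_right ?_ _)
    exact h2
  have h5 : ‖(β : ℂ) * Complex.I * A‖ = |β| * ‖A‖ := by
    rw [norm_mul, norm_mul, Complex.norm_I, mul_one, Complex.norm_real, Real.norm_eq_abs]
  calc ‖ghFourier M β‖ ≤ ‖(β : ℂ) * Complex.I * A‖ + |β| * ((β ^ 2 / 2) ^ j / j.factorial) := by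
        refine (norm_le_norm_add_norm_sub _ _).trans (add_le_add_right ?_ _)
        rwa [norm_sub_rev]
    _ ≤ _ := by
        rw [h5]
        nlinarith [mul_le_mul_of_nonneg_left h4 (abs_nonneg β)]

/-! ### Fourier series of the noise. -/

open MeasureTheory in
/-- The Fourier expansion of a `C¹` periodic function, with the coefficients `a n` of its
derivative. -/
theorem exists_hasSum_fourier_of_periodic {T γ : ℝ} (hT : 0 < T) {η : ℝ → ℝ}
    (hper : Function.Periodic η T) (hη : ContDiff ℝ 1 η) (hbd : ∀ y, |deriv η y| ≤ γ) :
    ∃ a b : ℤ → ℂ, (∀ n ≠ 0, ‖b n‖ = T / (2 * Real.pi * |(n : ℝ)|) * ‖a n‖) ∧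
      Summable (fun n => ‖a n‖ ^ 2) ∧ ∑' n, ‖a n‖ ^ 2 ≤ γ ^ 2 ∧
      ∀ y : ℝ, HasSum (fun n : ℤ => b n * Complex.exp (((2 * Real.pi * n / T * y : ℝ) : ℂ) *
        Complex.I)) (η y : ℂ) := by
  have : Fact (0 < T) := ⟨hT⟩
  have h0T : (0 : ℝ) < 0 + T := by simpa
  let f : ℝ → ℂ := fun y => η y
  let f' : ℝ → ℂ := fun y => (deriv η y : ℝ)
  have hder : ∀ y, HasDerivAt f (f' y) y := fun y =>
    ((hη.differentiable one_ne_zero).differentiableAt.hasDerivAt).ofReal_comp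
  have hf'c : Continuous f' := Complex.continuous_ofReal.comp (hη.continuous_deriv le_rfl)
  have hfc : Continuous f := Complex.continuous_ofReal.comp hη.continuous
  have hfper : Function.Periodic f T := fun y => by simp [f, hper y]
  let a : ℤ → ℂ := fourierCoeffOn h0T f'
  let b : ℤ → ℂ := fourierCoeffOn h0T f
  have hab : ∀ n ≠ 0, ‖b n‖ = T / (2 * Real.pi * |(n : ℝ)|) * ‖a n‖ := fun n hn => by
    have h := fourierCoeffOn_of_hasDerivAt h0T hn (fun x _ => hder x)
      (hf'c.intervalIntegrable 0 (0 + T))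
    rw [hfper 0, sub_self, mul_zero, zero_sub] at h
    simp only [b, a]
    rw [h]
    simp only [norm_mul, norm_div, norm_neg, Complex.norm_I, Complex.norm_intCast, zero_add,
      Complex.ofReal_zero, sub_zero, Complex.norm_real, Real.norm_eq_abs, abs_of_pos hT,
      abs_of_pos Real.pi_pos, norm_one, Complex.norm_ofNat, mul_one]
    ring
  have hmem : MemLp f' 2 (volume.restrict (Set.Ioc 0 (0 + T))) :=
    MemLp.of_bound hf'c.aestronglyMeasurable γ (Filter.Eventually.of_forall fun y => by
      simpa [f'] using hbd y)
  have hP := hasSum_sq_fourierCoeffOn h0T hmem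
  have hle : (0 + T - 0)⁻¹ • ∫ x in (0 : ℝ)..(0 + T), ‖f' x‖ ^ 2 ≤ γ ^ 2 := by
    have h := intervalIntegral.integral_mono_on (μ := volume) h0T.le
      (f := fun x => ‖f' x‖ ^ 2) (g := fun _ => γ ^ 2)
      ((hf'c.norm.pow 2).intervalIntegrable _ _) intervalIntegrable_const (fun x _ => by
        simpa [f'] using sq_le_sq' ((neg_nonpos.2 ((abs_nonneg _).trans (hbd x))).trans
          (abs_nonneg _)) (hbd x))
    rw [intervalIntegral.integral_const, zero_add, sub_zero, smul_eq_mul] at h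
    rw [zero_add, sub_zero, smul_eq_mul, inv_mul_le_iff₀ hT]
    exact h
  have hsum : Summable b := by
    -- AM–GM on |a n|/|n| gives absolute convergence, hence a pointwise expansion; the index 0,
    -- where `hab` says nothing, is the one exception.
    refine Summable.of_norm (Summable.of_norm_bounded_eventually
      (g := fun n : ℤ => T / (2 * Real.pi) * (1 / (n : ℝ) ^ 2) + T / (2 * Real.pi) * ‖a n‖ ^ 2)
      (((Real.summable_one_div_int_pow.2 one_lt_two).mul_left _).add (hP.summable.mul_left _)) ?_)
    refine (Set.finite_singleton (0 : ℤ)).subset fun n hn => ?_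
    by_contra h0
    refine hn ?_
    have hn0 : (n : ℝ) ≠ 0 := by exact_mod_cast h0
    change ‖‖b n‖‖ ≤ _
    rw [norm_norm, hab n h0, ← mul_add, ← div_div, div_mul_eq_mul_div, mul_div_assoc]
    refine mul_le_mul_of_nonneg_left ?_ (by positivity)
    have h1 : (1 : ℝ) / (n : ℝ) ^ 2 = (1 / |(n : ℝ)|) ^ 2 := by rw [div_pow, one_pow, sq_abs]
    have h2 : ‖a n‖ / |(n : ℝ)| = (1 / |(n : ℝ)|) * ‖a n‖ := by ring
    rw [h1, h2]
    nlinarith [sq_nonneg (1 / |(n : ℝ)| - ‖a n‖), sq_nonneg (1 / |(n : ℝ)|), sq_nonneg ‖a n‖]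
  let F : C(AddCircle T, ℂ) := ⟨AddCircle.liftIco T 0 f,
    AddCircle.liftIco_continuous (hfper 0).symm hfc.continuousOn⟩
  have hFc : fourierCoeff F = b := funext fun n => fourierCoeff_liftIco_eq f n
  refine ⟨a, b, hab, hP.summable, hP.tsum_eq.trans_le hle, fun y => ?_⟩
  have hs := has_pointwise_sum_fourier_series_of_summable (f := F) (by rwa [hFc]) (y : AddCircle T)
  have hFy : F y = (η y : ℂ) := by
    obtain ⟨z, hz, hzy⟩ := AddCircle.eq_coe_Ico (y : AddCircle T)
    have hz' : z ∈ Set.Ico 0 (0 + T) := by rwa [zero_add]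
    have h1 : F (z : AddCircle T) = f z := AddCircle.liftIco_coe_apply (f := f) hz'
    have h2 : f z = f y := by
      rw [← hfper.lift_coe z, ← hfper.lift_coe y]
      exact congrArg _ hzy
    rw [← hzy, h1, h2]
  rw [hFy, hFc] at hs
  convert hs using 2 with n
  rw [smul_eq_mul, fourier_coe_apply]
  congr 2
  push_cast
  ring

/-! ### The estimator on periodic noise. -/

/-- The Gauss–Hermite estimator of the derivative at `0` of the Gaussian smoothing of a function of
one variable. -/
noncomputable def ghDeriv (M : ℕ) (σ : ℝ) (η : ℝ → ℝ) : ℝ :=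
  1 / (√Real.pi * σ) * ∑ v ∈ ghNodes M, ghWeight M v * η (√2 * σ * v) * (√2 * v)

/-- The first moment vanishes, so `η 0` may be subtracted; the Lipschitz bound then leaves a second
moment. -/
theorem abs_ghDeriv_le {M : ℕ} (hM : 2 ≤ M) {σ γ : ℝ} (hσ : 0 < σ) {η : ℝ → ℝ}
    (hη : Differentiable ℝ η) (hbd : ∀ y, |deriv η y| ≤ γ) : |ghDeriv M σ η| ≤ γ := by
  have hpi : 0 < √Real.pi := Real.sqrt_pos.2 Real.pi_pos
  have h2 : √2 * √2 = 2 := Real.mul_self_sqrt zero_le_two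
  have hlip : ∀ y, |η y - η 0| ≤ γ * |y| := fun y => by
    simpa using Convex.norm_image_sub_le_of_norm_deriv_le (𝕜 := ℝ) (f := η) (s := Set.univ)
      (fun x _ => hη x) (fun x _ => hbd x) convex_univ (Set.mem_univ 0) (Set.mem_univ y)
  have h0 : ∑ v ∈ ghNodes M, ghWeight M v * v ^ 1 = 0 := by
    rw [sum_ghWeight_mul_pow (by omega)]; exact gaussInt_X_pow_odd 0
  have e : ghDeriv M σ η = 1 / (√Real.pi * σ) *
      ∑ v ∈ ghNodes M, ghWeight M v * (η (√2 * σ * v) - η 0) * (√2 * v) := by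
    have : ∑ v ∈ ghNodes M, ghWeight M v * η 0 * (√2 * v) = 0 := by
      calc _ = η 0 * √2 * ∑ v ∈ ghNodes M, ghWeight M v * v ^ 1 := by
            rw [Finset.mul_sum]; exact Finset.sum_congr rfl fun v _ => by ring
        _ = 0 := by rw [h0, mul_zero]
    simp only [ghDeriv, mul_sub, sub_mul, Finset.sum_sub_distrib, this, sub_zero]
  rw [e, abs_mul, abs_of_pos (by positivity)]
  calc _ ≤ 1 / (√Real.pi * σ) * ∑ v ∈ ghNodes M, 2 * σ * γ * (ghWeight M v * v ^ 2) := by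
        gcongr
        refine (Finset.abs_sum_le_sum_abs _ _).trans (Finset.sum_le_sum fun v hv => ?_)
        have hw := ghWeight_nonneg hv
        rw [abs_mul, abs_mul, abs_of_nonneg hw, abs_mul, abs_of_nonneg (Real.sqrt_nonneg 2)]
        have h := hlip (√2 * σ * v)
        rw [abs_mul, abs_mul, abs_of_nonneg (Real.sqrt_nonneg 2), abs_of_pos hσ] at h
        calc _ ≤ ghWeight M v * (γ * (√2 * σ * |v|)) * (√2 * |v|) := by gcongr
          _ = (√2 * √2) * σ * γ * (ghWeight M v * |v| ^ 2) := by ring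
          _ = _ := by rw [h2, sq_abs]
    _ = γ := by
        rw [← Finset.mul_sum, sum_ghWeight_mul_pow (by omega), gaussInt_X_pow_add_two, pow_zero,
          gaussInt_one]
        push_cast
        field_simp
        norm_num

/-- Parseval's bound for the Gauss–Hermite estimator on periodic functions. -/
theorem sq_ghDeriv_le_of_periodic {M : ℕ} (hM : 2 ≤ M) {T σ γ : ℝ} (hT : 0 < T) (hσ : 0 < σ)
    {η : ℝ → ℝ} (hper : Function.Periodic η T) (hη : ContDiff ℝ 1 η)
    (hbd : ∀ y, |deriv η y| ≤ γ) {m : ℤ → ℝ} (hms : Summable m) (hm0 : ∀ n, 0 ≤ m n)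
    (hm : ∀ n : ℤ, n ≠ 0 → (‖ghFourier M (2 * Real.pi * n / T * σ)‖ /
      |2 * Real.pi * n / T * σ|) ^ 2 ≤ m n) :
    ghDeriv M σ η ^ 2 ≤ γ ^ 2 * ∑' n, m n := by
  obtain ⟨a, b, hab, hasum, hale, hser⟩ := exists_hasSum_fourier_of_periodic hT hper hη hbd
  have hpi : 0 < √Real.pi := Real.sqrt_pos.2 Real.pi_pos
  have hE : HasSum (fun n : ℤ => (1 / σ : ℂ) * (b n * ghFourier M (2 * Real.pi * n / T * σ)))
      (ghDeriv M σ η : ℂ) := by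
    have h := hasSum_sum (s := ghNodes M) fun v _ => (hser (√2 * σ * v)).mul_left
      ((1 / (√Real.pi * σ) * (ghWeight M v * (√2 * v)) : ℝ) : ℂ)
    have e : (ghDeriv M σ η : ℂ) = ∑ v ∈ ghNodes M,
        ((1 / (√Real.pi * σ) * (ghWeight M v * (√2 * v)) : ℝ) : ℂ) * (η (√2 * σ * v) : ℂ) := by
      rw [ghDeriv, Finset.mul_sum, Complex.ofReal_sum]
      refine Finset.sum_congr rfl fun v _ => ?_
      push_cast
      ring
    rw [e]
    refine (congrArg (fun g : ℤ → ℂ => HasSum g _) (funext fun n => ?_)).mpr h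
    · rw [ghFourier, Finset.mul_sum, Finset.mul_sum]
      refine Finset.sum_congr rfl fun v _ => ?_
      rw [show √2 * (2 * Real.pi * n / T * σ) * v = 2 * Real.pi * n / T * (√2 * σ * v) by ring]
      have : (√Real.pi : ℂ) ≠ 0 := by exact_mod_cast hpi.ne'
      have : (σ : ℂ) ≠ 0 := by exact_mod_cast hσ.ne'
      push_cast
      field_simp
  -- The mean of the noise, which its derivative does not control, does not reach the estimator.
  have h0 : ghFourier M 0 = 0 := by
    have h0 : ∑ v ∈ ghNodes M, ghWeight M v * v ^ 1 = 0 := by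
      rw [sum_ghWeight_mul_pow (by omega)]; exact gaussInt_X_pow_odd 0
    simp only [pow_one] at h0
    simp only [ghFourier, mul_zero, zero_mul, Complex.ofReal_zero, Complex.exp_zero, mul_one]
    rw [← Complex.ofReal_sum, ← Finset.mul_sum, h0, mul_zero, Complex.ofReal_zero]
  have hterm : ∀ n : ℤ, ‖(1 / σ : ℂ) * (b n * ghFourier M (2 * Real.pi * n / T * σ))‖ ≤
      ‖a n‖ * √(m n) := fun n => by
    by_cases hn : n = 0
    · subst hn
      simp only [Int.cast_zero, mul_zero, zero_div, zero_mul, h0, norm_zero]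
      positivity
    have hn' : 0 < |(n : ℝ)| := abs_pos.2 (by exact_mod_cast hn)
    have h := Real.le_sqrt_of_sq_le (hm n hn)
    refine le_trans (le_of_eq ?_) (mul_le_mul_of_nonneg_left h (norm_nonneg (a n)))
    rw [norm_mul, norm_mul, hab n hn, norm_div, norm_one, Complex.norm_real, Real.norm_eq_abs,
      abs_mul, abs_div, abs_mul, abs_mul, abs_of_pos hσ, abs_of_pos hT, abs_of_pos Real.pi_pos,
      abs_two]
    field_simp
  have hsq : ∀ n, √(m n) ^ 2 = m n := fun n => Real.sq_sqrt (hm0 n)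
  have hCS := Real.inner_le_Lp_mul_Lq_tsum_of_nonneg (f := fun n => ‖a n‖) (g := fun n => √(m n))
    (p := 2) (q := 2) (Real.holderConjugate_iff.2 ⟨one_lt_two, by norm_num⟩)
    (fun n => norm_nonneg _) (fun n => Real.sqrt_nonneg _)
  simp only [Real.rpow_two, hsq, ← Real.sqrt_eq_rpow] at hCS
  have hCS := hCS hasum hms
  have hsumm : Summable fun n => ‖a n‖ * √(m n) := by
    refine Summable.of_nonneg_of_le (fun n => by positivity) (fun n => ?_) (hasum.add hms)
    have := hsq n
    nlinarith [sq_nonneg (‖a n‖ - √(m n)), sq_nonneg ‖a n‖, hm0 n]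
  have hb : |ghDeriv M σ η| ≤ √(γ ^ 2 * ∑' n, m n) := by
    rw [← Real.norm_eq_abs, ← Complex.norm_real, ← hE.tsum_eq]
    refine (tsum_of_norm_bounded hsumm.hasSum hterm).trans (hCS.trans ?_)
    rw [Real.sqrt_mul (sq_nonneg γ)]
    gcongr
  have hnn : 0 ≤ γ ^ 2 * ∑' n, m n := mul_nonneg (sq_nonneg _) (tsum_nonneg hm0)
  rw [← sq_abs]
  exact (Real.le_sqrt (abs_nonneg _) hnn).1 hb

/-- A geometric majorant, indexed by the nonzero integers, of the Gaussian Fourier weights. -/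
theorem hasSum_int_geometric (c : ℝ) {r : ℝ} (h0 : 0 ≤ r) (h1 : r < 1) :
    HasSum (fun n : ℤ => if n = 0 then 0 else c * r ^ (n.natAbs - 1)) (2 * c / (1 - r)) := by
  have hg : HasSum (fun n : ℕ => c * r ^ n) (c / (1 - r)) := by
    simpa [div_eq_mul_inv] using (hasSum_geometric_of_lt_one h0 h1).mul_left c
  have e : 2 * c / (1 - r) = c / (1 - r) + c / (1 - r) := by ring
  rw [e]
  refine HasSum.of_nat_of_neg_add_one ?_ ?_
  · rw [← hasSum_nat_add_iff' 1]
    have h1 : ∀ n : ℕ, (n : ℤ) + 1 ≠ 0 := fun n => by omega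
    have h2 : ∀ n : ℕ, ((n : ℤ) + 1).natAbs - 1 = n := fun n => by omega
    simpa [h1, h2] using hg
  · refine (congrArg (fun g : ℕ → ℝ => HasSum g _) (funext fun n => ?_)).mpr hg
    have h : -((n : ℤ) + 1) ≠ 0 := by omega
    rw [if_neg h, show (-((n : ℤ) + 1)).natAbs - 1 = n by omega]

open Filter Topology in
/-- On compact ranges of the smoothing radius, the Gauss–Hermite estimator with sufficiently many
nodes damps periodic functions as strongly as exact Gaussian smoothing. -/
theorem exists_forall_sq_ghDeriv_le {T σ₀ σ₁ : ℝ} (hT : 0 < T) (hσ₀ : 0 < σ₀) :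
    ∃ M₀ : ℕ, ∀ M ≥ M₀, 2 ≤ M → ∀ σ, σ₀ ≤ σ → σ ≤ σ₁ →
      Real.exp (-(2 * Real.pi ^ 2 * σ ^ 2 / T ^ 2)) ≤ 3 / 4 →
      ∀ (γ : ℝ) (η : ℝ → ℝ), Function.Periodic η T → ContDiff ℝ 1 η →
        (∀ y, |deriv η y| ≤ γ) →
        ghDeriv M σ η ^ 2 ≤
          γ ^ 2 * (11 / 4 * Real.exp (-(2 * Real.pi ^ 2 * σ ^ 2 / T ^ 2)) ^ 2) := by
  have hpi := Real.pi_pos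
  let Z : ℤ → ℝ := fun n => (2 * Real.pi * n / T * σ₁) ^ 2 / 2
  let e : ℕ → ℤ → ℝ := fun M n => 2 * (Z n ^ (M - 2) / (M - 2).factorial)
  let c : ℝ := (T / (2 * Real.pi * σ₀)) ^ 2
  -- The first entry, the excess of (q^(n²) + e)² over its leading term, tends to 0 for each n as M
  -- grows; the second dominates uniformly in M. Both use the worst radius in [σ₀, σ₁].
  let D : ℕ → ℤ → ℝ := fun M n => min (2 * e M n + e M n ^ 2) (c * (1 / (n : ℝ) ^ 2))
  have hZ : ∀ n, 0 ≤ Z n := fun n => by positivity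
  have he : ∀ M n, 0 ≤ e M n := fun M n => by have := hZ n; positivity
  have hD0 : ∀ M n, 0 ≤ D M n := fun M n => le_min (by have := he M n; positivity) (by positivity)
  have hcs : Summable fun n : ℤ => c * (1 / (n : ℝ) ^ 2) :=
    (Real.summable_one_div_int_pow.2 one_lt_two).mul_left _
  have hDle : ∀ M n, ‖D M n‖ ≤ c * (1 / (n : ℝ) ^ 2) := fun M n => by
    rw [Real.norm_of_nonneg (hD0 M n)]; exact min_le_right _ _
  have hDs : ∀ M, Summable (D M) := fun M => Summable.of_norm_bounded hcs (hDle M)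
  have hlim : Tendsto (fun M => ∑' n, D M n) atTop (𝓝 0) := by
    have hpt : ∀ n, Tendsto (fun M => D M n) atTop (𝓝 0) := fun n => by
      have h1 : Tendsto (fun M => e M n) atTop (𝓝 0) := by
        have := ((FloorSemiring.tendsto_pow_div_factorial_atTop (Z n)).comp
          (tendsto_sub_atTop_nat 2)).const_mul 2
        simpa using! this
      have h2 : Tendsto (fun M => 2 * e M n + e M n ^ 2) atTop (𝓝 0) := by
        simpa using (h1.const_mul 2).add (h1.pow 2)
      exact squeeze_zero (fun M => hD0 M n) (fun M => min_le_left _ _) h2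
    simpa using tendsto_tsum_of_dominated_convergence hcs hpt
      (Eventually.of_forall fun M => hDle M)
  have hε : 0 < 1 / 4 * Real.exp (-(2 * Real.pi ^ 2 * σ₁ ^ 2 / T ^ 2)) ^ 2 := by positivity
  obtain ⟨M₀, hM₀⟩ := eventually_atTop.1 (hlim.eventually (ge_mem_nhds hε))
  refine ⟨M₀, fun M hM hM2 σ h0 h1 hq γ η hper hη hbd => ?_⟩
  have hσ : 0 < σ := hσ₀.trans_le h0
  set κ : ℝ := 2 * Real.pi ^ 2 * σ ^ 2 / T ^ 2 with hκ
  have hκ0 : 0 ≤ κ := by positivity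
  set q := Real.exp (-κ) with hqd
  have hq0 : 0 < q := Real.exp_pos _
  have hr1 : q ^ 6 ≤ (3 / 4) ^ 6 := by gcongr
  have hr : q ^ 6 < 1 := hr1.trans_lt (by norm_num)
  have hgeo := hasSum_int_geometric (q ^ 2) (pow_nonneg hq0.le 6) hr
  have hsum : HasSum (fun n : ℤ => (if n = 0 then 0 else q ^ 2 * (q ^ 6) ^ (n.natAbs - 1)) + D M n)
      (2 * q ^ 2 / (1 - q ^ 6) + ∑' n, D M n) := hgeo.add (hDs M).hasSum
  refine (sq_ghDeriv_le_of_periodic hM2 hT hσ hper hη hbd hsum.summable (fun n => ?_)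
    (fun n hn => ?_)).trans ?_
  · have := hD0 M n
    split_ifs <;> positivity
  · rw [if_neg hn]
    have hn' : (n : ℝ) ≠ 0 := by exact_mod_cast hn
    set β := 2 * Real.pi * n / T * σ with hβ
    have hβ0 : 0 < |β| := abs_pos.2 (by positivity)
    rw [← min_add_add_left]
    refine le_min ?_ ?_
    · have h := norm_ghFourier_le (M := M) (j := M - 2) (by omega) β
      rw [mul_comm, ← div_le_iff₀ hβ0] at h
      have hexp : β ^ 2 / 2 = κ * (n.natAbs : ℝ) ^ 2 := by
        rw [hβ, hκ, Nat.cast_natAbs, Int.cast_abs, sq_abs]; field_simp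
      have hqn : Real.exp (-(β ^ 2 / 2)) = q ^ (n.natAbs ^ 2) := by
        rw [hqd, ← Real.exp_nat_mul, hexp]
        congr 1
        push_cast
        ring
      have hle : 2 * ((β ^ 2 / 2) ^ (M - 2) / (M - 2).factorial) ≤ e M n := by
        have : β ^ 2 / 2 ≤ Z n := by
          simp only [Z, hβ, mul_pow]
          gcongr
        simp only [e]
        gcongr
      rw [hqn] at h
      have h2 : ‖ghFourier M β‖ / |β| ≤ q ^ (n.natAbs ^ 2) + e M n :=
        h.trans (add_le_add_right hle _)
      have hq1 : q ≤ 1 := hq.trans (by norm_num)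
      have hp1 : q ^ (n.natAbs ^ 2) ≤ 1 := pow_le_one₀ hq0.le hq1
      -- For q ≤ 1 this is 2k² ≥ 2 + 6(k - 1) for integers k ≥ 1, with equality at 1 and 2.
      have hp2 : (q ^ (n.natAbs ^ 2)) ^ 2 ≤ q ^ 2 * (q ^ 6) ^ (n.natAbs - 1) := by
        rw [← pow_mul, ← pow_mul, ← pow_add]
        refine pow_le_pow_of_le_one hq0.le hq1 ?_
        obtain ⟨k, hk⟩ : ∃ k, n.natAbs = k + 1 := ⟨n.natAbs - 1, by omega⟩
        rw [hk, Nat.add_sub_cancel]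
        rcases k with _ | k
        · norm_num
        · ring_nf; nlinarith
      have h3 : (‖ghFourier M β‖ / |β|) ^ 2 ≤ (q ^ (n.natAbs ^ 2) + e M n) ^ 2 := by gcongr
      nlinarith [he M n, pow_nonneg hq0.le (n.natAbs ^ 2)]
    · have h := norm_ghFourier_le_one hM2 β
      have h2 : (‖ghFourier M β‖ / |β|) ^ 2 ≤ c * (1 / (n : ℝ) ^ 2) := by
        have hb : |β| = 2 * Real.pi * |(n : ℝ)| / T * σ := by
          rw [hβ, abs_mul, abs_div, abs_mul, abs_of_pos hσ, abs_of_pos hT,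
            abs_of_pos (by positivity : 0 < 2 * Real.pi)]
        have hn0 : 0 < |(n : ℝ)| := abs_pos.2 hn'
        calc _ ≤ (1 / (2 * Real.pi * |(n : ℝ)| / T * σ₀)) ^ 2 := by rw [hb]; gcongr
          _ = c * (1 / (n : ℝ) ^ 2) := by
            simp only [c]
            rw [← sq_abs (n : ℝ)]
            field_simp
      have : 0 ≤ q ^ 2 * (q ^ 6) ^ (n.natAbs - 1) := by positivity
      linarith
  · rw [hsum.tsum_eq]
    refine mul_le_mul_of_nonneg_left ?_ (sq_nonneg _)
    have hqσ : Real.exp (-(2 * Real.pi ^ 2 * σ₁ ^ 2 / T ^ 2)) ≤ q := by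
      rw [hqd, hκ]; gcongr
    -- The budget 11/4 is 5/2 for the geometric majorant, using q ≤ 3/4, plus 1/4 for the quadrature
    -- error.
    have h1 : ∑' n, D M n ≤ 1 / 4 * q ^ 2 := (hM₀ M hM).trans (by gcongr)
    have h2 : 2 * q ^ 2 / (1 - q ^ 6) ≤ 5 / 2 * q ^ 2 := by
      rw [div_le_iff₀ (by linarith)]
      have : q ^ 6 ≤ 1 / 5 := hr1.trans (by norm_num)
      nlinarith [sq_nonneg q]
    linarith

/-- With a suitable constant, the Gauss–Hermite estimator of every periodic function is bounded by
the terms of `delta`, uniformly in the number of nodes and the smoothing radius. -/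
theorem exists_const_sq_ghDeriv_le {L α γ : ℝ} (hL : 0 < L) (hα : 0 < α) (hγ : 0 ≤ γ) :
    ∃ C : ℝ, 0 < C ∧ ∀ M, 2 ≤ M → ∀ σ, 0 < σ → ∀ η : ℝ → ℝ, Function.Periodic η (1 / α) →
      ContDiff ℝ 1 η → (∀ y, |deriv η y| ≤ γ) →
      ghDeriv M σ η ^ 2 ≤ ghError C 1 M σ + 80 * L ^ 2 * σ ^ 2 +
        11 / 4 * (γ ^ 2 / Real.exp (4 * Real.pi ^ 2 * α ^ 2 * σ ^ 2)) := by
  have hpi := Real.pi_pos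
  have hσ₀ : 0 < 1 / (10 * α) := by positivity
  obtain ⟨M₀, hM₀⟩ := exists_forall_sq_ghDeriv_le (T := 1 / α) (σ₁ := γ / (8 * L))
    (by positivity) hσ₀
  -- Chosen so that the quadrature term with constant `K M` equals γ² at the smallest relevant
  -- radius 1/(10α); it increases with σ.
  let K : ℕ → ℝ := fun M => γ ^ 2 * (4 ^ M * ((2 * M).factorial : ℝ) ^ 2) /
    (Real.pi * (M.factorial : ℝ) ^ 2 * (1 / (10 * α)) ^ (4 * M - 2))
  have hK : ∀ M, 0 ≤ K M := fun M => by positivity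
  refine ⟨1 + ∑ M ∈ Finset.range M₀, K M,
    add_pos_of_pos_of_nonneg one_pos (Finset.sum_nonneg fun M _ => hK M),
    fun M hM σ hσ η hper hη hbd => ?_⟩
  set C := 1 + ∑ M ∈ Finset.range M₀, K M with hC
  have hC0 : 0 < C := add_pos_of_pos_of_nonneg one_pos (Finset.sum_nonneg fun M _ => hK M)
  have hgh : 0 ≤ ghError C 1 M σ := by unfold ghError; positivity
  have htriv : ghDeriv M σ η ^ 2 ≤ γ ^ 2 := by
    rw [← sq_abs]
    have := abs_ghDeriv_le hM hσ (hη.differentiable one_ne_zero) hbd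
    gcongr
  have hexp : Real.exp (-(2 * Real.pi ^ 2 * σ ^ 2 / (1 / α) ^ 2)) ^ 2 =
      1 / Real.exp (4 * Real.pi ^ 2 * α ^ 2 * σ ^ 2) := by
    rw [← Real.exp_nat_mul, one_div (Real.exp _), ← Real.exp_neg]
    congr 1
    field_simp
    push_cast
    ring
  set q := Real.exp (-(2 * Real.pi ^ 2 * σ ^ 2 / (1 / α) ^ 2)) with hq
  have hq0 : 0 < q := Real.exp_pos _
  rw [div_eq_mul_one_div (γ ^ 2), ← hexp]
  have hLσ : 0 ≤ 80 * L ^ 2 * σ ^ 2 := by positivity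
  rcases le_or_gt q (3 / 4) with hq34 | hq34
  · have hσ0 : 1 / (10 * α) ≤ σ := by
      by_contra! h
      have h1 : σ * (10 * α) < 1 := (lt_div_iff₀ (by positivity)).1 h
      have h2 : 2 * Real.pi ^ 2 * σ ^ 2 / (1 / α) ^ 2 < 1 / 4 := by
        have h3 : 2 * Real.pi ^ 2 * σ ^ 2 / (1 / α) ^ 2 =
            Real.pi ^ 2 / 50 * (σ * (10 * α)) ^ 2 := by
          field_simp
          ring
        have h4 : (σ * (10 * α)) ^ 2 ≤ 1 := pow_le_one₀ (by positivity) h1.le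
        have h5 : Real.pi ^ 2 / 50 < 1 / 4 := by nlinarith [Real.pi_lt_d2]
        rw [h3]
        exact (mul_le_of_le_one_right (by positivity) h4).trans_lt h5
      have h3 := Real.add_one_le_exp (-(2 * Real.pi ^ 2 * σ ^ 2 / (1 / α) ^ 2))
      linarith
    rcases le_or_gt σ (γ / (8 * L)) with hσ1 | hσ1
    · rcases le_or_gt M₀ M with hM1 | hM1
      · have h := hM₀ M hM1 hM σ hσ0 hσ1 hq34 γ η hper hη hbd
        linarith
      · have hKC : K M ≤ C := by
          have := Finset.single_le_sum (f := K) (fun M _ => hK M) (Finset.mem_range.2 hM1)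
          linarith
        have h1 : γ ^ 2 ≤ ghError C 1 M σ := by
          calc γ ^ 2 = ghError (K M) 1 M (1 / (10 * α)) := by
                simp only [ghError, K, Nat.cast_one, mul_one]
                field_simp
            _ ≤ ghError C 1 M σ := by unfold ghError; gcongr
        have : 0 ≤ 11 / 4 * (γ ^ 2 * q ^ 2) := by positivity
        linarith
    · have h1 : γ < σ * (8 * L) := (div_lt_iff₀ (by positivity)).1 hσ1
      have h2 : γ ^ 2 ≤ (σ * (8 * L)) ^ 2 := by gcongr
      have : 0 ≤ 11 / 4 * (γ ^ 2 * q ^ 2) := by positivity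
      nlinarith
  -- Weak damping: 11/4 · 9/16 > 1, so the exponential term exceeds the trivial bound γ².
  · have h1 : (3 / 4 : ℝ) ^ 2 ≤ q ^ 2 := by gcongr
    nlinarith [mul_le_mul_of_nonneg_left h1 (sq_nonneg γ), sq_nonneg γ]

/-! ### Gradient error for a smooth function with noise. -/

variable {d : ℕ}

local notation "E" => EuclideanSpace ℝ (Fin d)

/-- The mean value inequality on a ball costs a factor 2 against the sharp constant L/2, which the
later constants can afford. -/
theorem IsSmooth.abs_sub_le {L : ℝ} (hL : 0 ≤ L) {φ : E → ℝ} (hφ : IsSmooth L φ) (x h : E) :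
    |φ (x + h) - φ x - inner ℝ (gradient φ x) h| ≤ L * ‖h‖ ^ 2 := by
  have hd : Differentiable ℝ φ := hφ.1.differentiable one_ne_zero
  have hg : ∀ y, fderiv ℝ φ y = InnerProductSpace.toDual ℝ E (gradient φ y) := fun y =>
    (toDual_gradient ..).symm
  have key := (convex_closedBall x ‖h‖).norm_image_sub_le_of_norm_fderiv_le' (𝕜 := ℝ) (f := φ)
    (φ := fderiv ℝ φ x) (C := L * ‖h‖) (x := x) (y := x + h) (fun y _ => hd y) (fun y hy => ?_)
    (Metric.mem_closedBall_self (norm_nonneg _)) (by simp)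
  · rw [add_sub_cancel_left, hg, InnerProductSpace.toDual_apply_apply, Real.norm_eq_abs] at key
    linarith
  · rw [hg, hg, ← map_sub, LinearIsometryEquiv.norm_map]
    refine (hφ.2 y x).trans (mul_le_mul_of_nonneg_left ?_ hL)
    rwa [← dist_eq_norm]

/-- Use |v|³ ≤ (v² + v⁴)/2. For M = 2 the fourth moment is outside the exact range, but the nodes
satisfy v² = 1/2. -/
theorem sum_ghWeight_mul_abs_pow_three_le {M : ℕ} (hM : 2 ≤ M) :
    ∑ v ∈ ghNodes M, ghWeight M v * |v| ^ 3 ≤ 5 / 8 * √Real.pi := by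
  have hpi : 0 < √Real.pi := Real.sqrt_pos.2 Real.pi_pos
  have h2 : ∑ v ∈ ghNodes M, ghWeight M v * v ^ 2 = 1 / 2 * √Real.pi := by
    rw [sum_ghWeight_mul_pow (by omega), gaussInt_X_pow_add_two, pow_zero, gaussInt_one]
    norm_num
  have h4 : ∑ v ∈ ghNodes M, ghWeight M v * v ^ 4 ≤ 3 / 4 * √Real.pi := by
    rcases hM.eq_or_lt with rfl | hM
    · have hv : ∀ v ∈ ghNodes 2, ghWeight 2 v * v ^ 4 = 1 / 2 * (ghWeight 2 v * v ^ 2) := by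
        intro v hv
        have hH : hermiteH 2 = 4 * X ^ 2 - 2 := by
          rw [hermiteH_succ, hermiteH_succ]
          simp [hermiteH]
          ring
        have hv : (hermiteH 2).eval v = 0 := by
          simpa [ghNodes, hermiteH_ne_zero] using hv
        rw [hH] at hv
        simp at hv
        have : v ^ 2 = 1 / 2 := by linarith
        rw [show v ^ 4 = v ^ 2 * v ^ 2 by ring]
        nth_rewrite 1 [this]
        ring
      rw [Finset.sum_congr rfl hv, ← Finset.mul_sum, h2]
      linarith
    · rw [sum_ghWeight_mul_pow (by omega), gaussInt_X_pow_add_two, gaussInt_X_pow_add_two, pow_zero,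
        gaussInt_one]
      push_cast
      linarith
  calc _ ≤ ∑ v ∈ ghNodes M, (1 / 2 * (ghWeight M v * v ^ 2) + 1 / 2 * (ghWeight M v * v ^ 4)) := by
        refine Finset.sum_le_sum fun v hv => ?_
        have hw := ghWeight_nonneg hv
        have : |v| ^ 3 ≤ 1 / 2 * v ^ 2 + 1 / 2 * v ^ 4 := by
          rw [show v ^ 4 = (v ^ 2) ^ 2 by ring, ← sq_abs v]
          nlinarith [sq_nonneg (|v| * (|v| - 1))]
        nlinarith
    _ ≤ _ := by
        rw [Finset.sum_add_distrib, ← Finset.mul_sum, ← Finset.mul_sum, h2]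
        linarith

theorem IsSmooth.abs_ghDirDeriv_sub_le {L σ : ℝ} (hL : 0 ≤ L) (hσ : 0 < σ) {φ : E → ℝ}
    (hφ : IsSmooth L φ) {M : ℕ} (hM : 2 ≤ M) (x : E) {ξ : E} (hξ : ‖ξ‖ = 1) :
    |ghDirDeriv M σ φ x ξ - inner ℝ (gradient φ x) ξ| ≤ 9 / 5 * L * σ := by
  have hpi : 0 < √Real.pi := Real.sqrt_pos.2 Real.pi_pos
  have h2 : √2 * √2 = 2 := Real.mul_self_sqrt zero_le_two
  set g := inner ℝ (gradient φ x) ξ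
  have hrem : ∀ v : ℝ, |φ (x + (√2 * σ * v) • ξ) - φ x - √2 * σ * v * g| ≤
      2 * L * σ ^ 2 * |v| ^ 2 := fun v => by
    have h := hφ.abs_sub_le hL x ((√2 * σ * v) • ξ)
    rw [inner_smul_right, norm_smul, hξ, mul_one, Real.norm_eq_abs, abs_mul, abs_mul,
      abs_of_nonneg (Real.sqrt_nonneg 2), abs_of_pos hσ] at h
    refine h.trans_eq ?_
    linear_combination L * σ ^ 2 * |v| ^ 2 * h2
  have hm1 : ∑ v ∈ ghNodes M, ghWeight M v * v ^ 1 = 0 := by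
    rw [sum_ghWeight_mul_pow (by omega)]; exact gaussInt_X_pow_odd 0
  have hm2 : ∑ v ∈ ghNodes M, ghWeight M v * v ^ 2 = 1 / 2 * √Real.pi := by
    rw [sum_ghWeight_mul_pow (by omega), gaussInt_X_pow_add_two, pow_zero, gaussInt_one]
    norm_num
  have e : ghDirDeriv M σ φ x ξ - g = 1 / (√Real.pi * σ) * ∑ v ∈ ghNodes M,
      ghWeight M v * (φ (x + (√2 * σ * v) • ξ) - φ x - √2 * σ * v * g) * (√2 * v) := by
    have hs : ∑ v ∈ ghNodes M, ghWeight M v * (φ x + √2 * σ * v * g) * (√2 * v) =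
        σ * g * √Real.pi := by
      calc _ = φ x * √2 * ∑ v ∈ ghNodes M, ghWeight M v * v ^ 1 +
            (√2 * √2) * σ * g * ∑ v ∈ ghNodes M, ghWeight M v * v ^ 2 := by
            rw [Finset.mul_sum, Finset.mul_sum, ← Finset.sum_add_distrib]
            exact Finset.sum_congr rfl fun v _ => by ring
        _ = _ := by rw [hm1, hm2, h2]; ring
    simp only [sub_sub]
    simp only [mul_sub, sub_mul, Finset.sum_sub_distrib]
    rw [hs, ghDirDeriv]
    congr 1
    field_simp
  rw [e, abs_mul, abs_of_pos (by positivity)]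
  calc _ ≤ 1 / (√Real.pi * σ) * ∑ v ∈ ghNodes M, 2 * √2 * L * σ ^ 2 * (ghWeight M v * |v| ^ 3) := by
        gcongr
        refine (Finset.abs_sum_le_sum_abs _ _).trans (Finset.sum_le_sum fun v hv => ?_)
        have hw := ghWeight_nonneg hv
        rw [abs_mul, abs_mul, abs_of_nonneg hw, abs_mul, abs_of_nonneg (Real.sqrt_nonneg 2)]
        calc _ ≤ ghWeight M v * (2 * L * σ ^ 2 * |v| ^ 2) * (√2 * |v|) := by
              gcongr
              exact hrem v
          _ = _ := by ring
    _ ≤ 1 / (√Real.pi * σ) * (2 * √2 * L * σ ^ 2 * (5 / 8 * √Real.pi)) := by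
        rw [← Finset.mul_sum]
        gcongr
        exact sum_ghWeight_mul_abs_pow_three_le hM
    _ = 5 / 4 * √2 * L * σ := by field_simp; ring
    _ ≤ 9 / 5 * L * σ := by
        have : √2 ≤ 36 / 25 := Real.sqrt_le_iff.2 ⟨by norm_num, by norm_num⟩
        gcongr
        linarith

theorem sq_norm_ghGradient_sub {ξ : Fin d → E} (hξ : Orthonormal ℝ ξ) (M : ℕ) (σ : ℝ) (F : E → ℝ)
    (x g : E) : ‖ghGradient M σ ξ F x - g‖ ^ 2 =
      ∑ i, (ghDirDeriv M σ F x (ξ i) - inner ℝ g (ξ i)) ^ 2 := by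
  obtain ⟨b, hb⟩ : ∃ b : OrthonormalBasis (Fin d) ℝ E, ⇑b = ξ :=
    ⟨OrthonormalBasis.mk hξ (hξ.linearIndependent.span_eq_top_of_card_eq_finrank' (by simp)).ge,
      by simp⟩
  have hg : g = ∑ i, inner ℝ g (ξ i) • ξ i := by
    conv_lhs => rw [← b.sum_repr' g]
    simp [hb, real_inner_comm]
  have he : ghGradient M σ ξ F x - g =
      ∑ i, (ghDirDeriv M σ F x (ξ i) - inner ℝ g (ξ i)) • ξ i := by
    conv_lhs => rw [hg]
    simp only [ghGradient, sub_smul, Finset.sum_sub_distrib]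
  rw [he, ← real_inner_self_eq_norm_sq, hξ.inner_sum]
  simp [sq]

/-- The squared error of the DGS gradient for a smooth function with periodic noise. -/
theorem sq_norm_ghGradient_sub_gradient_le {L α γ C σ : ℝ} (hL : 0 ≤ L) (hσ : 0 < σ)
    (hC : 0 ≤ C) {M : ℕ} (hM : 2 ≤ M)
    (hnoise : ∀ η : ℝ → ℝ, Function.Periodic η (1 / α) →
      ContDiff ℝ 1 η → (∀ y, |deriv η y| ≤ γ) →
      ghDeriv M σ η ^ 2 ≤ ghError C 1 M σ + 80 * L ^ 2 * σ ^ 2 +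
        11 / 4 * (γ ^ 2 / Real.exp (4 * Real.pi ^ 2 * α ^ 2 * σ ^ 2)))
    {ξ : Fin d → E} (hξ : Orthonormal ℝ ξ) {φ ε : E → ℝ} (hφ : IsSmooth L φ)
    (hε : IsPeriodicNoise α γ ξ ε) (x : E) :
    ‖ghGradient M σ ξ (fun z => φ z + ε z) x - gradient φ x‖ ^ 2 ≤
      11 / 4 * (ghError C d M σ + 48 * L ^ 2 * d * σ ^ 2 +
        3 * γ ^ 2 * d / (2 * Real.exp (4 * Real.pi ^ 2 * α ^ 2 * σ ^ 2)) *
          (1 + 1 / (8 * Real.pi * α ^ 2 * σ ^ 2))) := by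
  have hpi := Real.pi_pos
  rw [sq_norm_ghGradient_sub hξ]
  set P := γ ^ 2 / Real.exp (4 * Real.pi ^ 2 * α ^ 2 * σ ^ 2) with hP
  have hP0 : 0 ≤ P := by positivity
  have hg0 : 0 ≤ ghError C 1 M σ := by unfold ghError; positivity
  have hterm : ∀ i, (ghDirDeriv M σ (fun z => φ z + ε z) x (ξ i) -
      inner ℝ (gradient φ x) (ξ i)) ^ 2 ≤
        11 / 4 * (ghError C 1 M σ + 48 * L ^ 2 * σ ^ 2 + 3 / 2 * P) := fun i => by
    obtain ⟨h1, h2, h3⟩ := hε x i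
    have hn := hnoise _ h1 h2 h3
    have ha := hφ.abs_ghDirDeriv_sub_le hL hσ hM x (hξ.1 i)
    have e : ghDirDeriv M σ (fun z => φ z + ε z) x (ξ i) =
        ghDirDeriv M σ φ x (ξ i) + ghDeriv M σ fun y => ε (x + y • ξ i) := by
      simp only [ghDirDeriv, ghDeriv]
      rw [← mul_add, ← Finset.sum_add_distrib]
      congr 1
      exact Finset.sum_congr rfl fun v _ => by ring
    rw [e]
    set A := ghDirDeriv M σ φ x (ξ i) - inner ℝ (gradient φ x) (ξ i)
    set B := ghDeriv M σ fun y => ε (x + y • ξ i)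
    have hA : A ^ 2 ≤ (9 / 5 * L * σ) ^ 2 := by rw [← sq_abs]; gcongr
    have hAB : (ghDirDeriv M σ φ x (ξ i) + B - inner ℝ (gradient φ x) (ξ i)) ^ 2 = (A + B) ^ 2 := by
      simp only [A]; ring
    rw [hAB]
    -- (A + B)² ≤ 3A² + (3/2)B². The L²σ² coefficient is 3 · 81/25 + 120 ≤ 11/4 · 48, and that of P
    -- matches exactly.
    nlinarith [sq_nonneg (2 * A - B), sq_nonneg (L * σ)]
  refine (Finset.sum_le_sum fun i _ => hterm i).trans ?_
  rw [Finset.sum_const, Finset.card_univ, Fintype.card_fin, nsmul_eq_mul]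
  have hgd : ghError C d M σ = d * ghError C 1 M σ := by
    simp only [ghError, Nat.cast_one]; ring
  have hPd : 3 * γ ^ 2 * d / (2 * Real.exp (4 * Real.pi ^ 2 * α ^ 2 * σ ^ 2)) =
      d * (3 / 2 * P) := by
    rw [hP]; field_simp
  rw [hgd, hPd]
  have : 0 ≤ d * (3 / 2 * P) * (1 / (8 * Real.pi * α ^ 2 * σ ^ 2)) := by positivity
  linarith

/-! ### Inexact gradient descent. -/

/-- Adding the convexity inequalities for two distinct points gives strong monotonicity of the
gradient, to compare with its Lipschitz bound. Distinct points require d ≠ 0. -/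
theorem IsStronglyConvex.le_of_isSmooth {L τ : ℝ} {φ : E → ℝ} (hφ : IsSmooth L φ)
    (hs : IsStronglyConvex τ φ) (hd : d ≠ 0) : τ ≤ L := by
  have : Nonempty (Fin d) := Fin.pos_iff_nonempty.1 (Nat.pos_of_ne_zero hd)
  obtain ⟨u, hu⟩ := exists_ne (0 : E)
  have h1 := hs 0 u
  have h2 := hs u 0
  have h3 := hφ.2 u 0
  have h4 := real_inner_le_norm (gradient φ u - gradient φ 0) u
  rw [inner_sub_left] at h4
  rw [zero_sub, inner_neg_right, norm_neg] at h2
  rw [sub_zero] at h1 h3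
  have hu' : 0 < ‖u‖ := norm_pos_iff.2 hu
  nlinarith [mul_le_mul_of_nonneg_right h3 hu'.le, sq_nonneg ‖u‖, sq_pos_of_pos hu']

/-- One gradient step with step size `1 / (16 L)` contracts the distance to the minimizer. -/
theorem sq_norm_gradient_step_le {L τ : ℝ} (hL : 0 < L) (hτ : 0 < τ) {φ : E → ℝ}
    (hφ : IsSmooth L φ) (hs : IsStronglyConvex τ φ) {xstar : E} (hmin : ∀ y, φ xstar ≤ φ y)
    (x : E) : ‖x - xstar - (1 / (16 * L)) • gradient φ x‖ ^ 2 ≤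
      (1 - 15 / 8 * (τ / (16 * L))) * ‖x - xstar‖ ^ 2 := by
  set g := gradient φ x
  set r := x - xstar
  have hg0 : gradient φ xstar = 0 := by
    have h : fderiv ℝ φ xstar = 0 :=
      IsLocalMin.fderiv_eq_zero (Filter.Eventually.of_forall hmin)
    rw [gradient, h, map_zero]
  have h1 := hs x xstar
  have h2 := hs xstar x
  rw [hg0, inner_zero_left, add_zero] at h2
  rw [show xstar - x = -r by simp [r], inner_neg_right, norm_neg] at h1
  -- An auxiliary step of length 1/(2L), optimal for the quadratic bound, lowers `φ` by at least
  -- ‖g‖²/(4L), which therefore bounds the gap to the minimum from below.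
  have h3 := (abs_le.1 (hφ.abs_sub_le hL.le x (-(1 / (2 * L)) • g))).2
  rw [inner_smul_right, real_inner_self_eq_norm_sq, norm_smul, mul_pow, Real.norm_eq_abs,
    sq_abs] at h3
  have h4 := hmin (x + -(1 / (2 * L)) • g)
  have h5 : ‖g‖ ^ 2 / (4 * L) ≤ φ x - φ xstar := by
    have : L * ((-(1 / (2 * L))) ^ 2 * ‖g‖ ^ 2) - 1 / (2 * L) * ‖g‖ ^ 2 = -(‖g‖ ^ 2 / (4 * L)) := by
      field_simp; ring
    linarith
  rw [norm_sub_sq_real, inner_smul_right, norm_smul, mul_pow, Real.norm_eq_abs, sq_abs,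
    real_inner_comm]
  have h6 : (1 / (16 * L)) ^ 2 * ‖g‖ ^ 2 = 1 / (64 * L) * (‖g‖ ^ 2 / (4 * L)) := by
    field_simp; ring
  have hl : 0 < 1 / (64 * L) := by positivity
  have e1 : 1 / (16 * L) = 4 * (1 / (64 * L)) := by field_simp; norm_num
  have e2 : τ / (16 * L) = 4 * τ * (1 / (64 * L)) := by field_simp; norm_num
  rw [h6, e1, e2]
  change φ xstar + τ / 2 * ‖r‖ ^ 2 ≤ φ x at h2
  have h7 : ‖g‖ ^ 2 / (4 * L) ≤ inner ℝ g r - τ / 2 * ‖r‖ ^ 2 := by linarith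
  have h8 : τ * ‖r‖ ^ 2 ≤ inner ℝ g r := by linarith
  have h9 := mul_le_mul_of_nonneg_left h7 hl.le
  have h10 := mul_le_mul_of_nonneg_left h8 hl.le
  nlinarith

/-- Young's inequality, weighted to give up 11a/8 of the contraction 15a/8 and keep a/2. -/
theorem sq_add_le_of_sq_le {a R Y W N : ℝ} (ha : 0 < a) (ha1 : a ≤ 1 / 16)
    (hN0 : 0 ≤ N) (hN : N ≤ Y + W) (hY : Y ^ 2 ≤ (1 - 15 / 8 * a) * R ^ 2) :
    N ^ 2 ≤ (1 - a / 2) * R ^ 2 + 8 / (11 * a) * W ^ 2 := by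
  have hb : 0 < 1 - 15 / 8 * a := by linarith
  set b := 1 - 15 / 8 * a with hbd
  have h1 : N ^ 2 ≤ (Y + W) ^ 2 := by gcongr
  have h2 : 2 * Y * W ≤ 11 * a / (8 * b) * Y ^ 2 + 8 * b / (11 * a) * W ^ 2 := by
    have : 11 * a / (8 * b) * Y ^ 2 + 8 * b / (11 * a) * W ^ 2 - 2 * Y * W =
        (11 * a * Y - 8 * b * W) ^ 2 / (88 * a * b) := by field_simp; ring
    have : 0 ≤ (11 * a * Y - 8 * b * W) ^ 2 / (88 * a * b) := by positivity
    linarith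
  have h3 : 11 * a / (8 * b) * Y ^ 2 ≤ 11 / 8 * a * R ^ 2 := by
    calc _ ≤ 11 * a / (8 * b) * (b * R ^ 2) := by gcongr
      _ = _ := by field_simp
  have h4 : W ^ 2 + 8 * b / (11 * a) * W ^ 2 ≤ 8 / (11 * a) * W ^ 2 := by
    have : 8 / (11 * a) * W ^ 2 - (W ^ 2 + 8 * b / (11 * a) * W ^ 2) = 4 / 11 * W ^ 2 := by
      rw [hbd]; field_simp; ring
    nlinarith [sq_nonneg W]
  rw [hbd] at hY
  nlinarith

theorem le_pow_mul_add_of_recursion {κ D : ℝ} (hκ : κ ≤ 1) (hD : 0 ≤ D) {u : ℕ → ℝ}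
    (hu : ∀ t, u (t + 1) ≤ (1 - κ) * u t + κ * D) (t : ℕ) : u t ≤ (1 - κ) ^ t * u 0 + D := by
  induction t with
  | zero => simpa using hD
  | succ t ih =>
    have := mul_le_mul_of_nonneg_left ih (sub_nonneg.2 hκ)
    rw [pow_succ]
    nlinarith [hu t]

theorem sq_norm_sub_le_of_isDGSDescent {L α γ C τ σ : ℝ} (hL : 0 < L) (hτ : 0 < τ) (hσ : 0 < σ)
    (hC : 0 ≤ C) {M : ℕ} (hM : 2 ≤ M)
    (hnoise : ∀ η : ℝ → ℝ, Function.Periodic η (1 / α) →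
      ContDiff ℝ 1 η → (∀ y, |deriv η y| ≤ γ) →
      ghDeriv M σ η ^ 2 ≤ ghError C 1 M σ + 80 * L ^ 2 * σ ^ 2 +
        11 / 4 * (γ ^ 2 / Real.exp (4 * Real.pi ^ 2 * α ^ 2 * σ ^ 2)))
    {ξ : Fin d → E} (hξ : Orthonormal ℝ ξ) {φ ε : E → ℝ} (hφ : IsSmooth L φ)
    (hs : IsStronglyConvex τ φ) (hε : IsPeriodicNoise α γ ξ ε) {xstar : E}
    (hmin : ∀ y, φ xstar ≤ φ y) {x : ℕ → E}
    (hx : IsDGSDescent (1 / (16 * L)) M σ ξ (fun z => φ z + ε z) x) (t : ℕ) :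
    ‖x t - xstar‖ ^ 2 ≤ (1 - τ / (32 * L)) ^ t * ‖x 0 - xstar‖ ^ 2 + delta C L τ α γ d M σ := by
  rcases eq_or_ne d 0 with rfl | hd
  · have h : ∀ t, x t - xstar = 0 := fun t => Subsingleton.elim _ _
    simp [h, delta, ghError]
  have hτL := hs.le_of_isSmooth hφ hd
  have hpi := Real.pi_pos
  set D := ghError C d M σ + 48 * L ^ 2 * d * σ ^ 2 +
        3 * γ ^ 2 * d / (2 * Real.exp (4 * Real.pi ^ 2 * α ^ 2 * σ ^ 2)) *
          (1 + 1 / (8 * Real.pi * α ^ 2 * σ ^ 2)) with hD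
  have hD0 : 0 ≤ D := by rw [hD]; unfold ghError; positivity
  have hdelta : delta C L τ α γ d M σ = (4 / τ ^ 2 + 1 / (4 * L * τ)) * D := rfl
  -- The 4/τ² part of the prefactor already suffices: 16/(11τ²) · 11/4 = 4/τ².
  have hδ : 4 / τ ^ 2 * D ≤ delta C L τ α γ d M σ := by
    rw [hdelta]
    gcongr
    linarith [show 0 < 1 / (4 * L * τ) by positivity]
  have hκ : τ / (32 * L) ≤ 1 := by
    rw [div_le_one (by positivity)]; linarith
  refine le_pow_mul_add_of_recursion (u := fun t => ‖x t - xstar‖ ^ 2) hκ (le_trans (by positivity) hδ)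
    (fun t => ?_) t
  set e := ghGradient M σ ξ (fun z => φ z + ε z) (x t) - gradient φ (x t) with he
  have hee : ‖e‖ ^ 2 ≤ 11 / 4 * D :=
    sq_norm_ghGradient_sub_gradient_le hL.le hσ hC hM hnoise hξ hφ hε (x t)
  have hstep : x (t + 1) - xstar =
      (x t - xstar - (1 / (16 * L)) • gradient φ (x t)) - (1 / (16 * L)) • e := by
    rw [hx t, he, smul_sub]; abel
  have ha : τ / (16 * L) ≤ 1 / 16 := by
    rw [div_le_div_iff₀ (by positivity) (by norm_num)]; linarith
  have h := sq_add_le_of_sq_le (a := τ / (16 * L)) (R := ‖x t - xstar‖) (by positivity) ha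
    (norm_nonneg (x (t + 1) - xstar)) (by rw [hstep]; exact norm_sub_le _ _)
    (sq_norm_gradient_step_le hL hτ hφ hs hmin (x t))
  refine h.trans ?_
  have h1 : τ / (16 * L) / 2 = τ / (32 * L) := by field_simp; norm_num
  have h2 : 8 / (11 * (τ / (16 * L))) * ‖(1 / (16 * L)) • e‖ ^ 2 =
      τ / (32 * L) * (16 / (11 * τ ^ 2) * ‖e‖ ^ 2) := by
    rw [norm_smul, mul_pow, Real.norm_eq_abs, sq_abs]; field_simp; ring
  have h3 : 16 / (11 * τ ^ 2) * ‖e‖ ^ 2 ≤ 4 / τ ^ 2 * D := by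
    calc _ ≤ 16 / (11 * τ ^ 2) * (11 / 4 * D) := by gcongr
      _ = _ := by field_simp; norm_num
  rw [h1, h2]
  have : τ / (32 * L) * (16 / (11 * τ ^ 2) * ‖e‖ ^ 2) ≤
      τ / (32 * L) * delta C L τ α γ d M σ := by
    gcongr
    exact h3.trans hδ
  linarith

/-! ### Choice of the smoothing radius. -/

/-- The choice of the smoothing radius in the high-frequency regime. -/
theorem delta_le_of_high_frequency {C L τ α γ σ : ℝ} (hL : 0 < L) (hα : 0 < α) (hτ : 0 < τ)
    (d M : ℕ) (h : 2 * L * √2 < Real.pi * α * γ)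
    (hσ : σ = 1 / (Real.pi * α * √2) * √(Real.log (Real.pi * α * γ / (2 * L * √2)))) :
    delta C L τ α γ d M σ ≤ (4 / τ ^ 2 + 1 / (4 * L * τ)) *
      (ghError C d M σ + 30 * L ^ 2 * d / (Real.pi ^ 2 * α ^ 2) *
        (Real.log (Real.pi * α * γ / (2 * L * √2)) +
          (Real.log (Real.pi * α * γ / (2 * L * √2)))⁻¹)) := by
  have hpi := Real.pi_pos
  have h2 : √2 ^ 2 = 2 := Real.sq_sqrt zero_le_two
  set ρ := Real.pi * α * γ / (2 * L * √2) with hρ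
  have hρ1 : 1 < ρ := (one_lt_div (by positivity)).2 h
  have hγ : γ = 2 * L * √2 * ρ / (Real.pi * α) := by rw [hρ]; field_simp
  set l := Real.log ρ with hl
  have hl0 : 0 < l := Real.log_pos hρ1
  have hσ2 : σ ^ 2 = l / (2 * Real.pi ^ 2 * α ^ 2) := by
    rw [hσ, mul_pow, Real.sq_sqrt hl0.le, div_pow, mul_pow, mul_pow, h2]
    field_simp
  have hexp : Real.exp (4 * Real.pi ^ 2 * α ^ 2 * σ ^ 2) = ρ ^ 2 := by
    rw [hσ2, show 4 * Real.pi ^ 2 * α ^ 2 * (l / (2 * Real.pi ^ 2 * α ^ 2)) = 2 * l by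
      field_simp; norm_num, two_mul, Real.exp_add, hl, Real.exp_log (by linarith), sq]
  unfold delta
  have hfac : 0 ≤ 4 / τ ^ 2 + 1 / (4 * L * τ) := by positivity
  refine mul_le_mul_of_nonneg_left ?_ hfac
  rw [hexp, add_assoc]
  refine add_le_add_right ?_ _
  have hA : 0 ≤ L ^ 2 * d / (Real.pi ^ 2 * α ^ 2) := by positivity
  have e1 : 48 * L ^ 2 * d * σ ^ 2 = L ^ 2 * d / (Real.pi ^ 2 * α ^ 2) * (24 * l) := by
    rw [hσ2]; field_simp; ring
  have e2 : 3 * γ ^ 2 * d / (2 * ρ ^ 2) * (1 + 1 / (8 * Real.pi * α ^ 2 * σ ^ 2)) =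
      L ^ 2 * d / (Real.pi ^ 2 * α ^ 2) * (12 + 3 * Real.pi * l⁻¹) := by
    have hρ0 : ρ ≠ 0 := by positivity
    rw [hσ2, hγ, div_pow, mul_pow, mul_pow, mul_pow, mul_pow, h2]
    field_simp
    ring
  have e3 : 30 * L ^ 2 * d / (Real.pi ^ 2 * α ^ 2) * (l + l⁻¹) =
      L ^ 2 * d / (Real.pi ^ 2 * α ^ 2) * (30 * (l + l⁻¹)) := by ring
  rw [e1, e2, e3, ← mul_add]
  refine mul_le_mul_of_nonneg_left ?_ hA
  have hi : 0 < l⁻¹ := inv_pos.2 hl0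
  have hli : l * l⁻¹ = 1 := mul_inv_cancel₀ hl0.ne'
  -- The constant 12 is at most 6(l + l⁻¹); then 24 + 6 = 30 and 6 + 3π < 30.
  have h12 : 2 ≤ l + l⁻¹ := by nlinarith [sq_nonneg (l - l⁻¹)]
  nlinarith [Real.pi_lt_d2]

/-- The choice of the smoothing radius in the low-frequency regime. -/
theorem delta_le_of_low_frequency {C L τ α γ σ : ℝ} (hL : 0 < L) (hα : 0 < α) (hτ : 0 < τ)
    (hγ : 0 ≤ γ) (d M : ℕ) (h : Real.pi * α * γ ≤ 2 * L * √2) (hσ : σ = 1 / α) :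
    delta C L τ α γ d M σ ≤ (4 / τ ^ 2 + 1 / (4 * L * τ)) *
      (ghError C d M σ + 64 * L ^ 2 * d / α ^ 2) := by
  have hpi := Real.pi_gt_three
  have hpi0 := Real.pi_pos
  have h2 : √2 ^ 2 = 2 := Real.sq_sqrt zero_le_two
  have hσ2 : α ^ 2 * σ ^ 2 = 1 := by rw [hσ]; field_simp
  have hs : σ ^ 2 = 1 / α ^ 2 := by rw [hσ, div_pow, one_pow]
  unfold delta
  have hfac : 0 ≤ 4 / τ ^ 2 + 1 / (4 * L * τ) := by positivity
  refine mul_le_mul_of_nonneg_left ?_ hfac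
  rw [add_assoc]
  refine add_le_add_right ?_ _
  have hγ2 : Real.pi ^ 2 * α ^ 2 * γ ^ 2 ≤ 8 * L ^ 2 := by
    have : (Real.pi * α * γ) ^ 2 ≤ (2 * L * √2) ^ 2 := by gcongr
    rw [mul_pow, mul_pow, mul_pow, mul_pow, h2] at this
    linarith
  have hγ3 : γ ^ 2 ≤ L ^ 2 / α ^ 2 := by
    rw [le_div_iff₀ (by positivity)]
    have h9 : 9 ≤ Real.pi ^ 2 := by nlinarith
    nlinarith [mul_le_mul_of_nonneg_right h9 (mul_nonneg (sq_nonneg α) (sq_nonneg γ))]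
  rw [mul_assoc (4 * Real.pi ^ 2), mul_assoc (8 * Real.pi), hσ2, mul_one, mul_one]
  have hx : 1 ≤ Real.exp (4 * Real.pi ^ 2) := Real.one_le_exp (by positivity)
  have hb : 1 / (8 * Real.pi) ≤ 1 := by
    rw [div_le_one (by positivity)]; linarith
  calc _ ≤ 48 * L ^ 2 * d * σ ^ 2 + 3 * (L ^ 2 / α ^ 2) * d / (2 * 1) * (1 + 1) := by gcongr
    _ = 51 * (L ^ 2 * d / α ^ 2) := by rw [hs]; ring
    _ ≤ 64 * (L ^ 2 * d / α ^ 2) := by gcongr; norm_num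
    _ = _ := by ring

end DGS

theorem theorem4p1 (L α γ₁ : ℝ) (hL : 0 < L) (hα : 0 < α) (hγ₁ : 0 ≤ γ₁) :
    ∃ C : ℝ, 0 < C ∧
      ∀ (d : ℕ) (ξ : Fin d → EuclideanSpace ℝ (Fin d)) (_ : Orthonormal ℝ ξ)
        (φ ε : EuclideanSpace ℝ (Fin d) → ℝ) (τ : ℝ) (_ : 0 < τ)
        (_ : DGS.IsSmooth L φ) (_ : DGS.IsStronglyConvex τ φ)
        (_ : DGS.IsPeriodicNoise α γ₁ ξ ε)
        (xstar : EuclideanSpace ℝ (Fin d)) (_ : ∀ y, φ xstar ≤ φ y)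
        (M : ℕ) (_ : 2 ≤ M),
        (∀ (σ : ℝ) (_ : 0 < σ) (x : ℕ → EuclideanSpace ℝ (Fin d))
            (_ : DGS.IsDGSDescent (1 / (16 * L)) M σ ξ (fun z => φ z + ε z) x) (t : ℕ),
            ‖x (t + 1) - xstar‖ ^ 2 ≤
              (1 - τ / (32 * L)) ^ (t + 1) * ‖x 0 - xstar‖ ^ 2 +
                DGS.delta C L τ α γ₁ d M σ) ∧
        (2 * L * √2 < Real.pi * α * γ₁ →
          ∀ (σ : ℝ) (_ : σ = 1 / (Real.pi * α * √2) *
              √(Real.log (Real.pi * α * γ₁ / (2 * L * √2)))),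
            DGS.delta C L τ α γ₁ d M σ ≤
              (4 / τ ^ 2 + 1 / (4 * L * τ)) *
                (DGS.ghError C d M σ +
                  30 * L ^ 2 * d / (Real.pi ^ 2 * α ^ 2) *
                    (Real.log (Real.pi * α * γ₁ / (2 * L * √2)) +
                      (Real.log (Real.pi * α * γ₁ / (2 * L * √2)))⁻¹))) ∧
        (Real.pi * α * γ₁ ≤ 2 * L * √2 →
          ∀ (σ : ℝ) (_ : σ = 1 / α),
            DGS.delta C L τ α γ₁ d M σ ≤
              (4 / τ ^ 2 + 1 / (4 * L * τ)) *
                (DGS.ghError C d M σ + 64 * L ^ 2 * d / α ^ 2)) := by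
  obtain ⟨C, hC, hnoise⟩ := DGS.exists_const_sq_ghDeriv_le hL hα hγ₁
  refine ⟨C, hC, fun d ξ hξ φ ε τ hτ hφ hs hε xstar hmin M hM =>
    ⟨fun σ hσ x hx t => ?_, fun h σ hσ => ?_, fun h σ hσ => ?_⟩⟩
  · exact DGS.sq_norm_sub_le_of_isDGSDescent hL hτ hσ hC.le hM (hnoise M hM σ hσ) hξ hφ hs hε hmin
      hx (t + 1)
  · exact DGS.delta_le_of_high_frequency hL hα hτ d M h hσ
  · exact DGS.delta_le_of_low_frequency hL hα hτ hγ₁ d M h hσ
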